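/- \textbf{Definitions.} Languages are over finite alphabets. The quotient of $L\subseteq\Sigma^*$ by $w$ is $w^{-1}L=\{x\mid wx\in L\}$; the complexity $\kappa(L)$ is the number of distinct quotients of $L$. The syntactic semigroup of $L$ is the quotient of $\Sigma^+$ by the congruence $x\sim y\iff(\forall w,z\in\Sigma^*:\ wxz\in L\Leftrightarrow wyz\in L)$. An atom of $L$ is an equivalence class of the relation on $\Sigma^*$ given by $x\approx y\iff(\forall w\in\Sigma^*:\ wx\in L\Leftrightarrow wy\in L)$; every atom $A$ is written $A_S$, where $S$ is the set of quotients of $L$ that contain $A$, so that $A$ is the intersection of the quotients in $S$ and of the complements of the quotients not in $S$. A left ideal is a non-empty $L$ with $L=\Sigma^*L$. A DFA is minimal if all its states are reachable and no two distinct states accept the same language. A binary boolean function $\circ$ is proper if it is neither constant nor a function of one variable only; $w\in L\circ L'$ iff $(w\in L)\circ(w\in L')$. For $n\ge4$ let $\mathcal D_n(a,b,c,d,e)$ be the DFA with states $Q_n=\{1,\dots,n\}$, alphabet $\Sigma=\{a,b,c,d,e\}$, initial state $1$, final state $n$, where $a$ acts as the cycle $(2,\dots,n)$, $b$ as the transposition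 $(2,3)$, $c$ maps $n$ to $2$ and fixes all other states, $d$ maps $n$ to $1$ and fixes all other states, and $e$ maps all states to $2$. Let $L_n=L_n(a,b,c,d,e)$ be its language. For a partial permutation $\pi$ of $\Sigma$ (a partial function that is injective on its domain), the dialect $L_n(\pi(a),\dots,\pi(e))$ is the image of $L_n$ under the substitution $x\mapsto\{\pi(x)\}$ if $\pi(x)$ is defined and $x\mapsto\emptyset$ otherwise, regarded as a language over the range of $\pi$; undefined values are written ``$-$''. A stream $(L_n\mid n\ge k)$ of languages of a class $C$, with $\kappa(L_n)=n$, together with the dialect stream given by $\pi$, is most complex in $C$ if, among the languages of $C$ (over arbitrary finite alphabets, both arguments of a binary operation being over the same alphabet) of the same complexities, the following are maximal for all $m,n\ge k$: the size of the syntactic semigroup of $L_n$; the complexity of each quotient of $L_n$ (i.e. for every $K\in C$ with $\kappa(K)=n$ there is a bijection $\varphi$ from the quotients of $K$ to those of $L_n$ with $\kappa(q)\le\kappa(\varphi(q))$); the number of atoms of $L_n$; the complexity of each atom $A_S$ of $L_n$ (in comparison with all atoms $A_{S'}$ of such $K$ with $|S'|=|S|$); the complexities of the reverse of $L_n$, of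 $L_n^*$, of $L_mL_n$, and of $L_m\circ L_n(\pi(\Sigma))$ for every proper $\circ$. \textbf{Theorem (Left Ideals).} For each $n\ge4$ the DFA $\mathcal D_n(a,b,c,d,e)$ is minimal and $L_n(a,b,c,d,e)$ is a left ideal of complexity $n$. The stream $(L_n(a,b,c,d,e)\mid n\ge4)$ with dialect stream $(L_n(a,b,e,d,c)\mid n\ge4)$ is most complex in the class of regular left ideals. Moreover the following hold for all $m,n\ge4$; all the dialects mentioned are left ideals of complexity $n$ (resp. $m$) over the restricted alphabets shown, and each stated value is an upper bound for the corresponding quantity for all regular left ideals of complexity $n$ (resp. $m$ and $n$, over a common alphabet), over any finite alphabet: \begin{enumerate} \item The syntactic semigroup of $L_n(a,b,c,d,e)$ has cardinality $n^{n-1}+n-1$. Moreover, fewer than five letters do not suffice: every regular left ideal of complexity $n$ over an alphabet with fewer than five letters has a syntactic semigroup of smaller cardinality. \item All quotients of $L_n(a,-,-,d,e)$ have complexity $n$. \item $L_n(a,-,c,d,e)$ has $2^{n-1}+1$ atoms. \item Each atom $A_S$ of $L_n(a,b,c,d,e)$ has complexity \[\kappa(A_S)=\begin{cases} n,&\text{if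 } |S|=n;\\ 2^{n-1},&\text{if } S=\emptyset;\\ 1+\sum_{x=1}^{|S|}\sum_{y=1}^{n-|S|}\binom{n-1}{x}\binom{n-x-1}{y-1},&\text{otherwise.}\end{cases}\] \item The reverse of $L_n(a,-,c,d,e)$ has complexity $2^{n-1}+1$. \item The star of $L_n(a,-,-,-,e)$ has complexity $n+1$. \item The product $L_m(a,-,-,-,e)\,L_n(a,-,-,-,e)$ has complexity $m+n-1$. \item For every proper binary boolean function $\circ$, the complexity of $L_m(a,-,c,-,e)\circ L_n(a,-,e,-,c)$ is $mn$. \end{enumerate} -/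

import Mathlib

open scoped Computability

namespace Language

variable {α : Type*}

/-- The set of left quotients `w⁻¹L = {x | wx ∈ L}` of `L`. -/
def quotients (L : Language α) : Set (Language α) := Set.range L.leftQuotient

/-- The (quotient) complexity `κ(L)`: the number of left quotients of `L`. -/
noncomputable def complexity (L : Language α) : ℕ∞ := L.quotients.encard

/-- The Myhill (syntactic) congruence of `L`, on the set of non-empty words. -/
def syntacticSetoid (L : Language α) : Setoid {x : List α // x ≠ []} where
  r x y := ∀ w z : List α, w ++ x.1 ++ z ∈ L ↔ w ++ y.1 ++ z ∈ L
  iseqv :=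
    ⟨fun _ _ _ => Iff.rfl, fun h w z => (h w z).symm, fun h k w z => (h w z).trans (k w z)⟩

/-- `σ(L)`: the cardinality of the syntactic semigroup of `L`. -/
noncomputable def syntacticSize (L : Language α) : ℕ∞ := ENat.card (Quotient L.syntacticSetoid)

/-- The left congruence of `L`: two words are related when they lie in the same quotients. -/
def atomSetoid (L : Language α) : Setoid (List α) where
  r x y := ∀ w : List α, w ++ x ∈ L ↔ w ++ y ∈ L
  iseqv := ⟨fun _ _ => Iff.rfl, fun h w => (h w).symm, fun h k w => (h w).trans (k w)⟩

/-- The atoms of `L`: the classes of the left congruence. -/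
def atoms (L : Language α) : Set (Language α) := {A | ∃ x : List α, A = {y | L.atomSetoid y x}}

/-- For an atom `A = A_S` of `L`, the set `S` of those quotients of `L` that occur uncomplemented
in the intersection defining `A`, i.e. of the quotients that contain `A`. -/
def atomIndex (L A : Language α) : Set (Language α) := {K ∈ L.quotients | A ≤ K}

/-- A left ideal: a non-empty language with `Σ*L = L`. -/
def IsLeftIdeal (L : Language α) : Prop := L ≠ 0 ∧ (⊤ : Language α) * L = L

open scoped Classical in
/-- The extension of a binary boolean function to languages. -/
def boolOp (f : Bool → Bool → Bool) (L L' : Language α) : Language α :=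
  {w | f (decide (w ∈ L)) (decide (w ∈ L')) = true}

/-- The image `s_π(L)` of `L` under the substitution `a ↦ {π(a)}` if `π(a)` is defined, and
`a ↦ ∅` if `π(a)` is undefined (`none`). -/
def dialect (π : α → Option α) (L : Language α) : Language α :=
  {w | ∃ u ∈ L, u.map π = w.map some}

/-- The dialect `s_π(L)` viewed as a language over the alphabet `Γ`
(in use, `Γ` is the range of `π`). -/
def dialectOver (Γ : Set α) (π : α → Option α) (L : Language α) : Language Γ :=
  {w | w.map Subtype.val ∈ L.dialect π}

end Language

/-- A DFA is minimal if all its states are reachable and no two distinct states accept the same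
language. -/
def DFA.IsMinimal {α σ : Type*} (M : DFA α σ) : Prop :=
  (∀ q, ∃ w, M.eval w = q) ∧ ∀ p q, M.acceptsFrom p = M.acceptsFrom q → p = q

namespace MostComplex

/-- A binary boolean function is proper if it is neither constant nor a function of one variable
only. -/
def IsProper (f : Bool → Bool → Bool) : Prop :=
  (¬ ∃ g : Bool → Bool, ∀ x y, f x y = g x) ∧ (¬ ∃ g : Bool → Bool, ∀ x y, f x y = g y)

/-- A partial permutation: a partial function that is injective on its domain. -/
def IsPartialPerm {σ : Type*} (π : σ → Option σ) : Prop :=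
  ∀ x y z, π x = some z → π y = some z → x = y

/-- The subclass `C_n` of the languages of complexity `n` of a class `C`. -/
def ofComplexity (C : ∀ α : Type, Set (Language α)) (n : ℕ) (α : Type) : Set (Language α) :=
  {L ∈ C α | L.complexity = n}

/-- The stream `(L_n | n ≥ k)` over the finite alphabet `σ`, with the dialect stream
`(s_π(L_n) | n ≥ k)`, is most complex in the class `C`. Maximality is over all languages of `C`
over all finite alphabets, with the same complexities. The quotients of `L_n` are compared one by
one with those of another language along a bijection; an atom `A_S` is compared with the atoms
`A_{S'}` such that `|S'| = |S|`. -/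
structure IsMostComplex (C : ∀ α : Type, Set (Language α)) {σ : Type} [Finite σ] (k : ℕ)
    (L : ∀ n, k ≤ n → Language σ) (π : σ → Option σ) : Prop where
  isPartialPerm : IsPartialPerm π
  mem : ∀ n hn, L n hn ∈ ofComplexity C n σ
  semigroup : ∀ n hn (α : Type) [Finite α], ∀ K ∈ ofComplexity C n α,
    K.syntacticSize ≤ (L n hn).syntacticSize
  quotient : ∀ n hn (α : Type) [Finite α], ∀ K ∈ ofComplexity C n α,
    ∃ φ : K.quotients ≃ (L n hn).quotients, ∀ q, q.1.complexity ≤ (φ q).1.complexity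
  atoms : ∀ n hn (α : Type) [Finite α], ∀ K ∈ ofComplexity C n α,
    K.atoms.encard ≤ (L n hn).atoms.encard
  atom : ∀ n hn (α : Type) [Finite α], ∀ K ∈ ofComplexity C n α,
    ∀ A ∈ K.atoms, ∀ B ∈ (L n hn).atoms,
      (K.atomIndex A).encard = ((L n hn).atomIndex B).encard → A.complexity ≤ B.complexity
  reverse : ∀ n hn (α : Type) [Finite α], ∀ K ∈ ofComplexity C n α,
    K.reverse.complexity ≤ (L n hn).reverse.complexity
  star : ∀ n hn (α : Type) [Finite α], ∀ K ∈ ofComplexity C n α,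
    (K∗).complexity ≤ ((L n hn)∗).complexity
  product : ∀ m hm n hn (α : Type) [Finite α],
    ∀ K ∈ ofComplexity C m α, ∀ K' ∈ ofComplexity C n α,
      (K * K').complexity ≤ (L m hm * L n hn).complexity
  boolean : ∀ m hm n hn (f : Bool → Bool → Bool), IsProper f → ∀ (α : Type) [Finite α],
    ∀ K ∈ ofComplexity C m α, ∀ K' ∈ ofComplexity C n α,
      (Language.boolOp f K K').complexity ≤
        (Language.boolOp f (L m hm) ((L n hn).dialect π)).complexity

/-- The class of regular left ideals. -/
def RegularLeftIdeal (α : Type) : Set (Language α) := {L | L.IsRegular ∧ L.IsLeftIdeal}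

/-- The alphabet `{a, b, c, d, e}`. -/
inductive Letter
  | a | b | c | d | e
  deriving DecidableEq

instance : Fintype Letter where
  elems := {.a, .b, .c, .d, .e}
  complete x := by cases x <;> simp

/-- The partial function `π` with `(π(a), π(b), π(c), π(d), π(e)) = (x₁, x₂, x₃, x₄, x₅)`. -/
def assign (x₁ x₂ x₃ x₄ x₅ : Option Letter) : Letter → Option Letter
  | .a => x₁
  | .b => x₂
  | .c => x₃
  | .d => x₄
  | .e => x₅

/-- The transformations `a : (2,…,n)`, `b : (2,3)`, `c : (n → 2)`, `d : (n → 1)`, `e : (Q_n → 2)`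
of `Q_n = {1,…,n}`; the state `q` of `Q_n` is represented by `q - 1` in `Fin n`. -/
def witnessStep {n : ℕ} (hn : 4 ≤ n) : Letter → Fin n → Fin n
  | .a => fun q =>
      if q.1 = 0 then q else if h : q.1 + 1 < n then ⟨q.1 + 1, h⟩ else ⟨1, by omega⟩
  | .b => Equiv.swap ⟨1, by omega⟩ ⟨2, by omega⟩
  | .c => Function.update id ⟨n - 1, by omega⟩ ⟨1, by omega⟩
  | .d => Function.update id ⟨n - 1, by omega⟩ ⟨0, by omega⟩
  | .e => fun _ => ⟨1, by omega⟩

/-- The DFA `D_n(a,b,c,d,e)`, with initial state `1` and the only final state `n`. -/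
def witnessDFA (n : ℕ) (hn : 4 ≤ n) : DFA Letter (Fin n) where
  step q x := witnessStep hn x q
  start := ⟨0, by omega⟩
  accept := {⟨n - 1, by omega⟩}

/-- The language `L_n(a,b,c,d,e)`. -/
def witness (n : ℕ) (hn : 4 ≤ n) : Language Letter := (witnessDFA n hn).accepts

/-- The dialect `L_n(π(a),π(b),π(c),π(d),π(e))` as a language over the alphabet `Γ`. -/
def witnessOver (n : ℕ) (hn : 4 ≤ n) (Γ : Set Letter) (π : Letter → Option Letter) :
    Language Γ :=
  (witness n hn).dialectOver Γ π

/-- The bound on the complexity of an atom `A_S` of a left ideal of complexity `n`, as a function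
of `n` and `s = |S|`; here `S` is the set of all quotients iff `s = n`. -/
def atomBound (n s : ℕ) : ℕ :=
  if s = n then n
  else if s = 0 then 2 ^ (n - 1)
  else 1 + ∑ x ∈ Finset.Icc 1 s, ∑ y ∈ Finset.Icc 1 (n - s),
    (n - 1).choose x * (n - x - 1).choose (y - 1)

end MostComplex

open MostComplex Language

/-!
Everything happens in a minimal DFA of the language, with states ordered by inclusion of the
languages they accept. For a left ideal the start state is the least state, and the action of
every word is monotone.

The upper bounds express these facts. The start state accepts a word `x` only if every state does,
which leaves `2 ^ (n - 1) + 1` possible sets of accepting states, that is, atoms, or quotients of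
the reverse. If the order is trivial above the start state, a transition fixes the start state
or is constant, which gives `n ^ (n - 1) + n - 1` maps; if there is a strict chain `start < p < q`,
monotonicity leaves fewer maps. A DFA realizing all maps of the first kind needs two letters
generating the permutations, one merging exactly two states other than the start state, one merging
the start state with another state, and one acting as a constant, hence five letters. A quotient of
the atom `A_S` is determined by the image of `S` and that of its complement, two disjoint sets
unless the quotient is empty, and the start state may be moved freely to the second set.

For the witness, `e` followed by a power of `a` is the constant map to any prescribed state other
than the start state, and `a, b` generate all permutations fixing the start state, so with `c, d`
every map allowed by the upper bound is the action of a word. The dialect obtained by exchanging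
`c` and `e` desynchronizes the two components of a direct product, making all pairs of states
reachable and distinguishable.
-/

namespace MostComplex

section Languages

variable {α : Type*} {L q : Language α}

theorem encard_range_eq_encard_range {ι β γ : Type*} {F : ι → β} {G : ι → γ}
    (h : ∀ x y, F x = F y ↔ G x = G y) : (Set.range F).encard = (Set.range G).encard := by
  have hker : Setoid.ker F = Setoid.ker G := Setoid.ext h
  rw [Set.encard, Set.encard, ← ENat.card_congr (Setoid.quotientKerEquivRange F), hker,
    ENat.card_congr (Setoid.quotientKerEquivRange G)]

theorem isLeftIdeal_iff : L.IsLeftIdeal ↔ L ≠ 0 ∧ ∀ u, L ≤ L.leftQuotient u := by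
  refine and_congr_right fun _ => ⟨fun h u w hw => ?_, fun h => ?_⟩
  · rw [← h]
    exact append_mem_mul (Set.mem_univ u) hw
  · refine le_antisymm ?_ fun w hw => mem_mul.2 ⟨[], Set.mem_univ _, w, hw, rfl⟩
    rintro _ ⟨u, -, w, hw, rfl⟩
    exact h u hw

theorem le_leftQuotient (hL : L.IsLeftIdeal) (u : List α) : L ≤ L.leftQuotient u :=
  (isLeftIdeal_iff.1 hL).2 u

theorem leftQuotient_mem_quotients (L : Language α) (w : List α) :
    L.leftQuotient w ∈ L.quotients := ⟨w, rfl⟩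

theorem self_mem_quotients (L : Language α) : L ∈ L.quotients := ⟨[], rfl⟩

theorem quotients_subset_of_mem_quotients (hq : q ∈ L.quotients) : q.quotients ⊆ L.quotients := by
  obtain ⟨w, rfl⟩ := hq
  rintro _ ⟨v, rfl⟩
  exact ⟨w ++ v, leftQuotient_append _ _ _⟩

theorem complexity_le_of_mem_quotients (hq : q ∈ L.quotients) : q.complexity ≤ L.complexity :=
  Set.encard_le_encard (quotients_subset_of_mem_quotients hq)

/-- The atom of `L` that contains the word `x`. -/
def atomOf (L : Language α) (x : List α) : Language α := {y | L.atomSetoid y x}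

theorem atoms_eq_range_atomOf (L : Language α) : L.atoms = Set.range (atomOf L) :=
  Set.ext fun _ => exists_congr fun _ => eq_comm

theorem atomOf_eq_atomOf_iff {x y : List α} : atomOf L x = atomOf L y ↔ L.atomSetoid x y := by
  refine ⟨fun h => ?_, fun h => ?_⟩
  · have hx : x ∈ atomOf L x := L.atomSetoid.refl x
    rwa [h] at hx
  · ext z
    exact ⟨fun hz => L.atomSetoid.trans hz h,
      fun hz => L.atomSetoid.trans hz (L.atomSetoid.symm h)⟩

theorem complexity_reverse (L : Language α) : L.reverse.complexity = L.atoms.encard := by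
  rw [complexity, quotients, atoms_eq_range_atomOf,
    ← (List.reverse_surjective (α := α)).range_comp (atomOf L)]
  refine encard_range_eq_encard_range fun x y => ?_
  have hmem (x z : List α) : z ∈ L.reverse.leftQuotient x ↔ z.reverse ++ x.reverse ∈ L := by
    rw [mem_leftQuotient, mem_reverse, List.reverse_append]
  rw [Function.comp_apply, Function.comp_apply, atomOf_eq_atomOf_iff]
  constructor
  · intro h w
    rw [← List.reverse_reverse w, ← hmem, ← hmem, h]
  · intro h
    ext z
    rw [hmem, hmem, h]

end Languages

section MinimalDFA

variable {α σ : Type*} {M : DFA α σ}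

/-- The transformation of the states of a DFA induced by a word. -/
def wordMap (M : DFA α σ) (w : List α) : σ → σ := fun q => M.evalFrom q w

theorem wordMap_append (M : DFA α σ) (u v : List α) :
    wordMap M (u ++ v) = wordMap M v ∘ wordMap M u :=
  funext fun q => M.evalFrom_of_append q u v

theorem mem_acceptsFrom_wordMap {q : σ} {w x : List α} :
    x ∈ M.acceptsFrom (wordMap M w q) ↔ w ++ x ∈ M.acceptsFrom q := by
  rw [DFA.mem_acceptsFrom, DFA.mem_acceptsFrom, DFA.evalFrom_of_append, wordMap]

/-- The transition semigroup of a DFA: the transformations induced by the non-empty words. -/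
def transitions (M : DFA α σ) : Set (σ → σ) := wordMap M '' {w | w ≠ []}

/-- The set of the states from which a DFA accepts the word `x`. In a minimal DFA it determines
the atom of `x`, and it corresponds to the set of the quotients that contain this atom. -/
def acceptingStates (M : DFA α σ) (x : List α) : Set σ := {q | x ∈ M.acceptsFrom q}

theorem acceptingStates_append (M : DFA α σ) (w x : List α) :
    acceptingStates M (w ++ x) = wordMap M w ⁻¹' acceptingStates M x :=
  Set.ext fun _ => mem_acceptsFrom_wordMap.symm

/-- The words that are accepted from all states of `X` and from no state of `Y`. The atom `A_S` of
a minimal DFA is the cell of `S` and `Sᶜ`, and the quotients of a cell are again cells. -/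
def cell (M : DFA α σ) (X Y : Set σ) : Language α :=
  {y | X ⊆ acceptingStates M y ∧ Disjoint Y (acceptingStates M y)}

theorem mem_cell {X Y : Set σ} {y : List α} :
    y ∈ cell M X Y ↔ X ⊆ acceptingStates M y ∧ Disjoint Y (acceptingStates M y) := Iff.rfl

theorem mem_cell_compl {S : Set σ} {y : List α} :
    y ∈ cell M S Sᶜ ↔ acceptingStates M y = S := by
  rw [mem_cell, Set.disjoint_compl_left_iff_subset, subset_antisymm_iff, and_comm]

theorem leftQuotient_cell (M : DFA α σ) (X Y : Set σ) (w : List α) :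
    (cell M X Y).leftQuotient w = cell M (wordMap M w '' X) (wordMap M w '' Y) := by
  ext y
  rw [mem_leftQuotient, mem_cell, mem_cell, acceptingStates_append, Set.image_subset_iff,
    Set.disjoint_image_left]

theorem quotients_cell (M : DFA α σ) (X Y : Set σ) :
    (cell M X Y).quotients = Set.range fun w => cell M (wordMap M w '' X) (wordMap M w '' Y) :=
  congrArg Set.range (funext (leftQuotient_cell M X Y))

theorem quotients_accepts (hM : M.IsMinimal) : M.accepts.quotients = Set.range M.acceptsFrom := by
  have heval : Function.Surjective M.eval := hM.1
  rw [quotients, leftQuotient_accepts, heval.range_comp]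

theorem acceptsFrom_injective (hM : M.IsMinimal) : Function.Injective M.acceptsFrom := hM.2

theorem complexity_accepts (hM : M.IsMinimal) : M.accepts.complexity = ENat.card σ := by
  rw [complexity, quotients_accepts hM, ← Set.image_univ, (acceptsFrom_injective hM).encard_image,
    Set.encard_univ]

theorem forall_append_mem_accepts_iff (hM : M.IsMinimal) {x y : List α} :
    (∀ w, w ++ x ∈ M.accepts ↔ w ++ y ∈ M.accepts) ↔
      acceptingStates M x = acceptingStates M y := by
  have hmem (w x : List α) : w ++ x ∈ M.accepts ↔ M.eval w ∈ acceptingStates M x :=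
    mem_acceptsFrom_wordMap.symm
  have heval : Function.Surjective M.eval := hM.1
  simp only [hmem, Set.ext_iff, heval.forall]

theorem syntacticSetoid_iff (hM : M.IsMinimal) (x y : {x : List α // x ≠ []}) :
    M.accepts.syntacticSetoid x y ↔ wordMap M x = wordMap M y := by
  have hstates : M.accepts.syntacticSetoid x y ↔
      ∀ z, acceptingStates M (x ++ z) = acceptingStates M (y ++ z) := by
    simp only [← forall_append_mem_accepts_iff hM, ← List.append_assoc]
    exact forall_comm
  simp only [hstates, acceptingStates_append]
  refine ⟨fun h => funext fun q => acceptsFrom_injective hM ?_, fun h z => by rw [h]⟩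
  ext z
  exact Set.ext_iff.1 (h z) q

theorem syntacticSize_accepts (hM : M.IsMinimal) :
    M.accepts.syntacticSize = (transitions M).encard := by
  have hker : M.accepts.syntacticSetoid =
      Setoid.ker fun w : {x : List α // x ≠ []} => wordMap M w.1 :=
    Setoid.ext (syntacticSetoid_iff hM)
  rw [syntacticSize, hker, ENat.card_congr (Setoid.quotientKerEquivRange _), transitions,
    Set.image_eq_range]
  rfl

theorem encard_atoms_accepts (hM : M.IsMinimal) :
    M.accepts.atoms.encard = (Set.range (acceptingStates M)).encard := by
  rw [atoms_eq_range_atomOf]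
  exact encard_range_eq_encard_range fun x y =>
    atomOf_eq_atomOf_iff.trans (forall_append_mem_accepts_iff hM)

theorem atomOf_accepts (hM : M.IsMinimal) (x : List α) :
    atomOf M.accepts x = cell M (acceptingStates M x) (acceptingStates M x)ᶜ := by
  ext y
  rw [mem_cell_compl]
  exact forall_append_mem_accepts_iff hM

theorem atomIndex_atomOf (hM : M.IsMinimal) (x : List α) :
    M.accepts.atomIndex (atomOf M.accepts x) = M.acceptsFrom '' acceptingStates M x := by
  ext K
  rw [atomIndex, quotients_accepts hM, atomOf_accepts hM]
  constructor
  · rintro ⟨⟨q, rfl⟩, hle⟩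
    exact ⟨q, hle (mem_cell_compl.2 rfl), rfl⟩
  · rintro ⟨q, hq, rfl⟩
    exact ⟨⟨q, rfl⟩, fun y hy => hy.1 hq⟩

theorem ncard_atomIndex_atomOf (hM : M.IsMinimal) (x : List α) :
    (M.accepts.atomIndex (atomOf M.accepts x)).ncard = (acceptingStates M x).ncard := by
  rw [atomIndex_atomOf hM, Set.ncard_image_of_injective _ (acceptsFrom_injective hM)]

theorem acceptsFrom_start_le (hM : M.IsMinimal) (hL : M.accepts.IsLeftIdeal) (q : σ) :
    M.accepts ≤ M.acceptsFrom q := by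
  obtain ⟨w, rfl⟩ := hM.1 q
  rw [← leftQuotient_accepts_apply]
  exact le_leftQuotient hL w

theorem acceptsFrom_wordMap_mono {p q : σ} (h : M.acceptsFrom p ≤ M.acceptsFrom q)
    (w : List α) : M.acceptsFrom (wordMap M w p) ≤ M.acceptsFrom (wordMap M w q) :=
  fun _ hx => mem_acceptsFrom_wordMap.2 (h (mem_acceptsFrom_wordMap.1 hx))

theorem acceptsFrom_toDFA (L : Language α) (s : Set.range L.leftQuotient) :
    L.toDFA.acceptsFrom s = s.1 := by
  have heval (w : List α) : (L.toDFA.evalFrom s w).1 = s.1.leftQuotient w := by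
    induction w using List.reverseRecOn with
    | nil => rfl
    | append_singleton w a ih =>
      rw [DFA.evalFrom_append_singleton, step_toDFA, ih, leftQuotient_append]
  ext x
  rw [DFA.mem_acceptsFrom, mem_accept_toDFA, heval, mem_leftQuotient, List.append_nil]

theorem isMinimal_toDFA (L : Language α) : L.toDFA.IsMinimal := by
  refine ⟨?_, fun p q h => ?_⟩
  · rintro ⟨_, w, rfl⟩
    refine ⟨w, Subtype.ext ?_⟩
    rw [← acceptsFrom_toDFA, ← leftQuotient_accepts_apply, accepts_toDFA]
  · rw [acceptsFrom_toDFA, acceptsFrom_toDFA] at h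
    exact Subtype.ext h

theorem exists_isMinimal_of_mem_ofComplexity {α : Type} {n : ℕ} {K : Language α}
    (hK : K ∈ ofComplexity RegularLeftIdeal n α) :
    ∃ (σ : Type) (_ : Fintype σ) (M : DFA α σ), Fintype.card σ = n ∧ M.IsMinimal ∧
      M.accepts = K ∧ M.accepts.IsLeftIdeal := by
  obtain ⟨⟨hreg, hideal⟩, hcomp⟩ := hK
  have hmin := isMinimal_toDFA K
  have hacc := accepts_toDFA K
  let _ := hreg.finite_range_leftQuotient.fintype
  refine ⟨_, inferInstance, K.toDFA, ?_, hmin, hacc, hacc.symm ▸ hideal⟩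
  have hcard := complexity_accepts hmin
  rw [hacc, hcomp, ENat.card_eq_coe_fintype_card] at hcard
  exact_mod_cast hcard.symm

end MinimalDFA

section MonotoneSelfMaps

/-- The transformations that fix `z` or are constant. With `z` the initial state of the minimal DFA,
they form the largest possible transition semigroup of a left ideal. -/
def fixOrConst {Q : Type*} (z : Q) : Set (Q → Q) := {f | f z = z ∨ ∃ r, f = Function.const Q r}

theorem ncard_fixing {Q : Type*} [Fintype Q] (z : Q) :
    {f : Q → Q | f z = z}.ncard = Fintype.card Q ^ (Fintype.card Q - 1) := by
  classical
  have hpreimage : {f : Q → Q | f z = z} = Equiv.funSplitAt z Q ⁻¹' ({z} ×ˢ Set.univ) := by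
    ext f
    simp
  rw [hpreimage, Set.ncard_preimage_of_injective_subset_range (Equiv.injective _) (by simp),
    Set.ncard_prod, Set.ncard_singleton, Set.ncard_univ, Nat.card_eq_fintype_card,
    Fintype.card_fun, Fintype.card_subtype_compl, Fintype.card_subtype_eq, one_mul]

theorem ncard_fixOrConst {Q : Type*} [Fintype Q] (z : Q) :
    (fixOrConst z).ncard = Fintype.card Q ^ (Fintype.card Q - 1) + Fintype.card Q - 1 := by
  have hunion : fixOrConst z = {f : Q → Q | f z = z} ∪ Function.const Q '' {z}ᶜ := by
    ext f
    constructor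
    · rintro (h | ⟨r, rfl⟩)
      · exact Or.inl h
      · exact (em (r = z)).imp id fun hr => ⟨r, hr, rfl⟩
    · rintro (h | ⟨r, -, rfl⟩)
      · exact Or.inl h
      · exact Or.inr ⟨r, rfl⟩
  have hdisjoint : Disjoint {f : Q → Q | f z = z} (Function.const Q '' {z}ᶜ) := by
    rw [Set.disjoint_left]
    rintro _ h ⟨r, hr, rfl⟩
    exact hr h
  have : Nonempty Q := ⟨z⟩
  have hpos : 0 < Fintype.card Q := Fintype.card_pos
  rw [hunion, Set.ncard_union_eq hdisjoint, ncard_fixing,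
    Set.ncard_image_of_injective _ Function.const_injective, Set.ncard_compl, Set.ncard_singleton,
    Nat.card_eq_fintype_card]
  omega

theorem two_mul_pow_le_succ_pow {j k : ℕ} (hj : j ≤ k) (hk : k ≠ 0) :
    2 * j ^ k ≤ (j + 1) ^ k := by
  have hle : j * j ^ (k - 1) ≤ k * j ^ (k - 1) := Nat.mul_le_mul_right _ hj
  have hbernoulli := pow_add_mul_le_add_pow (a := j) (b := 1) (Nat.zero_le _) (by omega) k
  rw [mul_pow_sub_one hk] at hle
  simp only [Nat.cast_id] at hbernoulli
  linarith

theorem three_terms_le_succ_pow (m k : ℕ) :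
    m ^ (k + 2) + (k + 2) * m ^ (k + 1) + (k + 2).choose 2 * m ^ k ≤ (m + 1) ^ (k + 2) := by
  rw [add_pow, Finset.sum_range_succ, Finset.sum_range_succ, Finset.sum_range_succ,
    Nat.choose_self, Nat.choose_succ_self_right, Nat.choose_symm_add (a := k) (b := 2)]
  simp only [one_pow, mul_one, Nat.cast_id]
  linarith [Nat.zero_le (∑ i ∈ Finset.range k, m ^ i * (k + 2).choose i)]

theorem two_mul_succ_pow_le {k : ℕ} (hk : 4 ≤ k) : 2 * (k + 1) ^ k ≤ (k + 2) ^ k := by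
  obtain ⟨j, rfl⟩ := Nat.exists_eq_add_of_le' (show 2 ≤ k by omega)
  have hchoose : j + 3 ≤ (j + 2).choose 2 := by
    rw [Nat.choose_two_right, Nat.le_div_iff_mul_le two_pos, show j + 2 - 1 = j + 1 by omega]
    nlinarith
  calc 2 * (j + 3) ^ (j + 2)
      = (j + 3) ^ (j + 2) + (j + 2) * (j + 3) ^ (j + 1) + (j + 3) * (j + 3) ^ j := by ring
    _ ≤ (j + 3) ^ (j + 2) + (j + 2) * (j + 3) ^ (j + 1) + (j + 2).choose 2 * (j + 3) ^ j := by
        gcongr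
    _ ≤ (j + 4) ^ (j + 2) := three_terms_le_succ_pow (j + 3) j

theorem sum_succ_mul_pow_le {k j : ℕ} (hk : k ≠ 0) (hj : j ≤ k) :
    ∑ u ∈ Finset.Icc 1 j, (u + 1) * u ^ k ≤ j * (j + 1) ^ k := by
  induction j with
  | zero => simp
  | succ j ih =>
    rw [Finset.sum_Icc_succ_top (by omega)]
    calc ∑ u ∈ Finset.Icc 1 j, (u + 1) * u ^ k + (j + 1 + 1) * (j + 1) ^ k
        ≤ j * (j + 1) ^ k + (j + 2) * (j + 1) ^ k := by gcongr; exact ih (by omega)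
      _ = (j + 1) * (2 * (j + 1) ^ k) := by ring
      _ ≤ (j + 1) * (j + 1 + 1) ^ k := by gcongr; exact two_mul_pow_le_succ_pow hj hk

theorem sum_succ_mul_pow_lt {n : ℕ} (hn : 4 ≤ n) :
    ∑ u ∈ Finset.Icc 1 n, (u + 1) * u ^ (n - 2) < 2 * (n ^ (n - 1) + n - 1) := by
  obtain ⟨k, rfl⟩ := Nat.exists_eq_add_of_le' (show 2 ≤ n by omega)
  rw [show k + 2 - 2 = k by omega, show k + 2 - 1 = k + 1 by omega]
  by_cases hk : 4 ≤ k
  · rw [Finset.sum_Icc_succ_top (by omega), Finset.sum_Icc_succ_top (by omega)]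
    calc ∑ u ∈ Finset.Icc 1 k, (u + 1) * u ^ k + (k + 1 + 1) * (k + 1) ^ k
          + (k + 1 + 1 + 1) * (k + 1 + 1) ^ k
        ≤ k * (k + 1) ^ k + (k + 1 + 1) * (k + 1) ^ k + (k + 1 + 1 + 1) * (k + 1 + 1) ^ k := by
          gcongr
          exact sum_succ_mul_pow_le (by omega) le_rfl
      _ = (k + 1) * (2 * (k + 1) ^ k) + (k + 3) * (k + 2) ^ k := by ring
      _ ≤ (k + 1) * (k + 2) ^ k + (k + 3) * (k + 2) ^ k := by
          gcongr
          exact two_mul_succ_pow_le hk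
      _ = 2 * (k + 2) ^ (k + 1) := by ring
      _ < 2 * ((k + 2) ^ (k + 1) + (k + 2) - 1) := by omega
  · interval_cases k <;> first | omega | decide

variable {Q : Type*} [PartialOrder Q]

open scoped Classical in
/- In a linear extension of the order, the up-sets have the sizes `1, …, s.card`. -/
theorem sum_card_filter_ge_le {g : ℕ → ℕ} (hg : Monotone g) (s : Finset Q) :
    ∑ r ∈ s, g {x ∈ s | r ≤ x}.card ≤ ∑ u ∈ Finset.Icc 1 s.card, g u := by
  induction h : s.card generalizing s with
  | zero => simp [Finset.card_eq_zero.1 h]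
  | succ k ih =>
    obtain ⟨m, hm⟩ := s.exists_minimal (Finset.card_pos.1 (by omega))
    have hcard : (s.erase m).card = k := by rw [Finset.card_erase_of_mem hm.1]; omega
    have hfilter : ∀ r ∈ s.erase m, {x ∈ s | r ≤ x} = {x ∈ s.erase m | r ≤ x} := by
      intro r hr
      rw [Finset.filter_erase, Finset.erase_eq_of_notMem]
      intro hmem
      have hrm := (Finset.mem_filter.1 hmem).2
      exact Finset.ne_of_mem_erase hr (hrm.antisymm (hm.2 (Finset.mem_of_mem_erase hr) hrm))
    rw [Finset.sum_Icc_succ_top (by omega), ← Finset.sum_erase_add _ _ hm.1]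
    refine add_le_add ?_ (hg (h ▸ Finset.card_filter_le _ _))
    rw [Finset.sum_congr rfl fun r hr => by rw [hfilter r hr]]
    exact ih _ hcard

open scoped Classical in
theorem two_mul_card_filter_fst_le_snd_le (s : Finset Q) :
    2 * {x ∈ s ×ˢ s | x.1 ≤ x.2}.card ≤ (s.card + 1) * s.card := by
  have hgauss (k : ℕ) : 2 * ∑ u ∈ Finset.Icc 1 k, u = (k + 1) * k := by
    induction k with
    | zero => rfl
    | succ k ih => rw [Finset.sum_Icc_succ_top (by omega), mul_add, ih]; ring
  rw [Finset.card_filter, Finset.sum_product, ← hgauss]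
  simp only [← Finset.card_filter]
  exact Nat.mul_le_mul_left 2 (sum_card_filter_ge_le monotone_id s)

variable [Fintype Q] [OrderBot Q] {p q : Q}

open scoped Classical in
theorem two_mul_card_monotone_filter_le (hp : ⊥ < p) (hpq : p < q) (r : Q) :
    2 * {f : Q → Q | Monotone f ∧ f ⊥ = r}.toFinset.card ≤
      (({x | r ≤ x} : Finset Q).card + 1) *
        ({x | r ≤ x} : Finset Q).card ^ (Fintype.card Q - 2) := by
  set U : Finset Q := {x | r ≤ x} with hU
  set R : Finset Q := {⊥, p, q}ᶜ with hR
  have htriple : ({⊥, p, q} : Finset Q).card = 3 :=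
    Finset.card_eq_three.2 ⟨_, _, _, hp.ne, (hp.trans hpq).ne, hpq.ne, rfl⟩
  have hcardR : R.card = Fintype.card Q - 3 := by rw [hR, Finset.card_compl, htriple]
  have hcardQ : 3 ≤ Fintype.card Q := htriple ▸ Finset.card_le_univ _
  have hle : {f : Q → Q | Monotone f ∧ f ⊥ = r}.toFinset.card ≤
      ({x ∈ U ×ˢ U | x.1 ≤ x.2} ×ˢ Fintype.piFinset fun _ : R => U).card := by
    refine Finset.card_le_card_of_injOn (fun f => ((f p, f q), fun x => f x)) ?_ ?_
    · intro f hf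
      obtain ⟨hmono, rfl⟩ : Monotone f ∧ f ⊥ = r := by simpa using hf
      have hfU : ∀ x, f x ∈ U := fun x => by simpa [hU] using hmono bot_le
      simp [hfU, hmono hpq.le]
    · intro f hf g hg h
      obtain ⟨-, hf⟩ : Monotone f ∧ f ⊥ = r := by simpa using hf
      obtain ⟨-, hg⟩ : Monotone g ∧ g ⊥ = r := by simpa using hg
      simp only [Prod.mk.injEq] at h
      funext x
      by_cases hx : x ∈ R
      · exact congr_fun h.2 ⟨x, hx⟩
      · simp only [hR, Finset.mem_compl, Finset.mem_insert, Finset.mem_singleton, not_not] at hx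
        rcases hx with rfl | rfl | rfl
        exacts [hf.trans hg.symm, h.1.1, h.1.2]
  rw [Finset.card_product, Fintype.card_piFinset, Finset.prod_const, Finset.card_univ,
    Fintype.card_coe, hcardR] at hle
  calc 2 * {f : Q → Q | Monotone f ∧ f ⊥ = r}.toFinset.card
      ≤ 2 * ({x ∈ U ×ˢ U | x.1 ≤ x.2}.card * U.card ^ (Fintype.card Q - 3)) := by gcongr
    _ = 2 * {x ∈ U ×ˢ U | x.1 ≤ x.2}.card * U.card ^ (Fintype.card Q - 3) := by ring
    _ ≤ (U.card + 1) * U.card * U.card ^ (Fintype.card Q - 3) :=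
        Nat.mul_le_mul_right _ (two_mul_card_filter_fst_le_snd_le U)
    _ = (U.card + 1) * U.card ^ (Fintype.card Q - 2) := by
        rw [mul_assoc, ← pow_succ']; congr 2; omega

theorem ncard_monotone_lt (hQ : 4 ≤ Fintype.card Q) (hp : ⊥ < p) (hpq : p < q) :
    {f : Q → Q | Monotone f}.ncard <
      Fintype.card Q ^ (Fintype.card Q - 1) + Fintype.card Q - 1 := by
  classical
  have hfiber : {f : Q → Q | Monotone f}.ncard =
      ∑ r : Q, {f : Q → Q | Monotone f ∧ f ⊥ = r}.toFinset.card := by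
    rw [Set.ncard_eq_toFinset_card', Finset.card_eq_sum_card_fiberwise
      (f := fun f : Q → Q => f ⊥) (t := Finset.univ) fun _ _ => Finset.mem_univ _]
    refine Finset.sum_congr rfl fun r _ => congrArg _ ?_
    ext f
    simp
  have hg : Monotone fun u => (u + 1) * u ^ (Fintype.card Q - 2) :=
    fun a b hab => Nat.mul_le_mul (by omega) (Nat.pow_le_pow_left hab _)
  refine Nat.lt_of_mul_lt_mul_left (a := 2) ?_
  calc 2 * {f : Q → Q | Monotone f}.ncard
      ≤ ∑ r : Q, (({x | r ≤ x} : Finset Q).card + 1) *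
          ({x | r ≤ x} : Finset Q).card ^ (Fintype.card Q - 2) := by
        rw [hfiber, Finset.mul_sum]
        exact Finset.sum_le_sum fun r _ => two_mul_card_monotone_filter_le hp hpq r
    _ ≤ ∑ u ∈ Finset.Icc 1 (Fintype.card Q), (u + 1) * u ^ (Fintype.card Q - 2) :=
        sum_card_filter_ge_le hg Finset.univ
    _ < _ := sum_succ_mul_pow_lt hQ

end MonotoneSelfMaps

section TransitionSemigroup

variable {α σ : Type*} {M : DFA α σ} {p q : σ}

theorem monotone_mem_fixOrConst {Q : Type*} [PartialOrder Q] [OrderBot Q]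
    (hflat : ∀ p q : Q, ⊥ < p → p ≤ q → p = q) {f : Q → Q} (hf : Monotone f) :
    f ∈ fixOrConst (⊥ : Q) := by
  by_cases h : f ⊥ = ⊥
  · exact Or.inl h
  · exact Or.inr ⟨f ⊥, funext fun x => (hflat _ _ (bot_lt_iff_ne_bot.2 h) (hf bot_le)).symm⟩

/- Inclusion of quotients is a partial order on the states of the minimal DFA, which has the initial
state as its least element and is respected by all transformations. -/
theorem ncard_transitions_lt_or_subset [Fintype σ] (hσ : 4 ≤ Fintype.card σ) (hM : M.IsMinimal)
    (hL : M.accepts.IsLeftIdeal) :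
    (transitions M).ncard < Fintype.card σ ^ (Fintype.card σ - 1) + Fintype.card σ - 1 ∨
      transitions M ⊆ fixOrConst M.start := by
  let _ : PartialOrder σ := PartialOrder.lift M.acceptsFrom (acceptsFrom_injective hM)
  let _ : OrderBot σ := { bot := M.start, bot_le := acceptsFrom_start_le hM hL }
  have hmono : transitions M ⊆ {f : σ → σ | Monotone f} := by
    rintro _ ⟨w, -, rfl⟩ p q hpq
    exact acceptsFrom_wordMap_mono hpq w
  by_cases hflat : ∀ p q : σ, ⊥ < p → p ≤ q → p = q
  · exact Or.inr fun f hf => monotone_mem_fixOrConst hflat (hmono hf)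
  · push Not at hflat
    obtain ⟨p, q, hp, hpq, hne⟩ := hflat
    exact Or.inl ((Set.ncard_le_ncard hmono (Set.toFinite _)).trans_lt
      (ncard_monotone_lt hσ hp (lt_of_le_of_ne hpq hne)))

/-- The transformation `f` identifies `p` with `q`, and no other two states. Every set of generators
of the largest transition semigroup contains one that merges only two non-initial states, and one
that merges only the initial state with another state. -/
def MergesOnly {Q : Type*} (f : Q → Q) (p q : Q) : Prop :=
  ∀ r s, r ≠ s → (f r = f s ↔ s(r, s) = s(p, q))

theorem mergesOnly_update [DecidableEq σ] (p q : σ) :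
    MergesOnly (Function.update id p q) p q := by
  intro r s hrs
  simp only [Function.update_apply, Sym2.eq_iff, id]
  grind

theorem MergesOnly.eq {Q : Type*} {f : Q → Q} {p q : Q} (h : MergesOnly f p q) (hpq : p ≠ q) :
    f p = f q :=
  (h p q hpq).2 rfl

theorem MergesOnly.of_comp {Q : Type*} {f g h : Q → Q} {p q : Q}
    (hm : MergesOnly (h ∘ g ∘ f) p q) (hf : Function.Bijective f)
    (hg : ¬ Function.Injective g) : MergesOnly g (f p) (f q) := by
  have hmerge : ∀ r s, r ≠ s → g (f r) = g (f s) → s(r, s) = s(p, q) :=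
    fun r s hrs hgrs => (hm r s hrs).1 (congrArg h hgrs)
  have hpq : g (f p) = g (f q) := by
    obtain ⟨r, s, hgrs, hrs⟩ := Function.not_injective_iff.1 hg
    obtain ⟨r, rfl⟩ := hf.2 r
    obtain ⟨s, rfl⟩ := hf.2 s
    rcases Sym2.eq_iff.1 (hmerge r s (fun h => hrs (h ▸ rfl)) hgrs) with ⟨rfl, rfl⟩ | ⟨rfl, rfl⟩
    exacts [hgrs, hgrs.symm]
  intro r s hrs
  constructor
  · obtain ⟨r, rfl⟩ := hf.2 r
    obtain ⟨s, rfl⟩ := hf.2 s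
    intro hgrs
    rw [← Sym2.map_mk, ← Sym2.map_mk, hmerge r s (fun h => hrs (h ▸ rfl)) hgrs]
  · intro h
    rcases Sym2.eq_iff.1 h with ⟨rfl, rfl⟩ | ⟨rfl, rfl⟩
    exacts [hpq, hpq.symm]

theorem wordMap_cons (M : DFA α σ) (x : α) (w : List α) :
    wordMap M (x :: w) = wordMap M w ∘ wordMap M [x] :=
  wordMap_append M [x] w

theorem exists_append_not_injective (M : DFA α σ) {w : List α}
    (hw : ¬ Function.Injective (wordMap M w)) :
    ∃ u x v, w = u ++ x :: v ∧ Function.Injective (wordMap M u) ∧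
      ¬ Function.Injective (wordMap M [x]) := by
  induction w with
  | nil => exact absurd Function.injective_id hw
  | cons y w ih =>
    by_cases hy : Function.Injective (wordMap M [y])
    · obtain ⟨u, x, v, rfl, hu, hx⟩ := ih fun h => hw (wordMap_cons M y w ▸ h.comp hy)
      exact ⟨y :: u, x, v, rfl, wordMap_cons M y u ▸ hu.comp hy, hx⟩
    · exact ⟨[], y, w, rfl, Function.injective_id, hy⟩

theorem injective_wordMap_of_mem [Finite σ] {w : List α}
    (hw : Function.Injective (wordMap M w)) {x : α} (hx : x ∈ w) :
    Function.Injective (wordMap M [x]) := by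
  obtain ⟨u, v, rfl⟩ := List.append_of_mem hx
  rw [wordMap_append] at hw
  have hv : Function.Injective (wordMap M (x :: v)) :=
    hw.of_comp_right (Finite.surjective_of_injective hw.of_comp)
  rw [wordMap_cons] at hv
  exact hv.of_comp

theorem wordMap_mem_transitions {w : List α} (hw : w ≠ []) : wordMap M w ∈ transitions M :=
  ⟨w, hw, rfl⟩

theorem wordMap_start_of_injective [Nontrivial σ] (hM : transitions M ⊆ fixOrConst M.start)
    {u : List α} (hu : Function.Injective (wordMap M u)) : wordMap M u M.start = M.start := by
  rcases eq_or_ne u [] with rfl | h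
  · rfl
  · rcases hM (wordMap_mem_transitions h) with h | ⟨r, hr⟩
    · exact h
    · obtain ⟨s, hs⟩ := exists_ne M.start
      rw [hr] at hu
      exact absurd (@hu s M.start rfl) hs

theorem exists_step_mergesOnly [Finite σ] (hM : transitions M = fixOrConst M.start)
    (hp : p ≠ M.start) (hpq : p ≠ q) :
    ∃ (x : α) (p' q' : σ), p' ≠ q' ∧ MergesOnly (wordMap M [x]) p' q' ∧
      p' ≠ M.start ∧ (q' = M.start ↔ q = M.start) := by
  classical
  have : Nontrivial σ := ⟨p, q, hpq⟩
  have hmem : Function.update id p q ∈ transitions M := by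
    rw [hM]
    exact Or.inl (Function.update_of_ne hp.symm _ _)
  obtain ⟨w, -, hw⟩ := hmem
  have hmerge : MergesOnly (wordMap M w) p q := hw ▸ mergesOnly_update p q
  obtain ⟨u, x, v, rfl, hu, hx⟩ :=
    exists_append_not_injective M fun h => hpq (h (hmerge.eq hpq))
  have hstart := wordMap_start_of_injective hM.le hu
  rw [wordMap_append, wordMap_cons] at hmerge
  refine ⟨x, _, _, hu.ne hpq, hmerge.of_comp (Finite.injective_iff_bijective.1 hu) hx, ?_, ?_⟩
  · exact hstart ▸ hu.ne hp
  · nth_rw 1 [← hstart]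
    exact hu.eq_iff

theorem exists_step_const [Nontrivial σ] (hM : transitions M = fixOrConst M.start) :
    ∃ (x : α) (r : σ), wordMap M [x] = Function.const σ r := by
  suffices ∃ x, wordMap M [x] M.start ≠ M.start by
    obtain ⟨x, hx⟩ := this
    rcases hM.le (wordMap_mem_transitions (List.cons_ne_nil x [])) with h | ⟨r, hr⟩
    · exact absurd h hx
    · exact ⟨x, r, hr⟩
  by_contra! h
  have hfix (w : List α) : wordMap M w M.start = M.start := by
    induction w with
    | nil => rfl
    | cons y w ih => rw [wordMap_cons, Function.comp_apply, h, ih]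
  obtain ⟨r, hr⟩ := exists_ne M.start
  obtain ⟨w, -, hw⟩ : Function.const σ r ∈ transitions M := hM ▸ Or.inr ⟨r, rfl⟩
  exact hr ((congr_fun hw M.start).symm.trans (hfix w))

/- A single injective letter would generate a commutative group, but `(p, q)` and `(q, r)` do not
commute. -/
theorem exists_two_injective_steps [Finite σ] (hM : transitions M = fixOrConst M.start) {p q r : σ}
    (hp : p ≠ M.start) (hq : q ≠ M.start) (hr : r ≠ M.start) (hpq : p ≠ q) (hpr : p ≠ r)
    (hqr : q ≠ r) :
    ∃ x y : α, x ≠ y ∧ Function.Injective (wordMap M [x]) ∧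
      Function.Injective (wordMap M [y]) := by
  classical
  have hswap (s t : σ) (hs : s ≠ M.start) (ht : t ≠ M.start) :
      ∃ w : List α, w ≠ [] ∧ wordMap M w = Equiv.swap s t ∧
        ∀ x ∈ w, Function.Injective (wordMap M [x]) := by
    obtain ⟨w, hne, hw⟩ : (Equiv.swap s t : σ → σ) ∈ transitions M :=
      hM ▸ Or.inl (Equiv.swap_apply_of_ne_of_ne hs.symm ht.symm)
    exact ⟨w, hne, hw, fun x => injective_wordMap_of_mem (hw ▸ (Equiv.swap s t).injective)⟩
  obtain ⟨u, hu, hupq, huinj⟩ := hswap p q hp hq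
  obtain ⟨v, -, hvqr, hvinj⟩ := hswap q r hq hr
  by_contra! hcon
  obtain ⟨x, hx⟩ := List.exists_mem_of_ne_nil u hu
  have heq (y : α) (hy : Function.Injective (wordMap M [y])) : y = x :=
    by_contra fun hne => hcon x y (Ne.symm hne) (huinj x hx) hy
  have hcomm : u ++ v = v ++ u := by
    rw [List.eq_replicate_length.2 fun y hy => heq y (huinj y hy),
      List.eq_replicate_length.2 fun y hy => heq y (hvinj y hy),
      List.replicate_append_replicate, List.replicate_append_replicate, add_comm]
  have happly := congr_fun (congrArg (wordMap M) hcomm) p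
  rw [wordMap_append, wordMap_append, hupq, hvqr, Function.comp_apply, Function.comp_apply,
    Equiv.swap_apply_left, Equiv.swap_apply_left, Equiv.swap_apply_of_ne_of_ne hpq hpr,
    Equiv.swap_apply_left] at happly
  exact hqr happly.symm

theorem five_le_card [Finite α] [Fintype σ] (hM : transitions M = fixOrConst M.start)
    (hσ : 4 ≤ Fintype.card σ) : 5 ≤ Nat.card α := by
  classical
  obtain ⟨p, hp, q, hq, r, hr, hpq, hpr, hqr⟩ :
      ∃ p ≠ M.start, ∃ q ≠ M.start, ∃ r ≠ M.start, p ≠ q ∧ p ≠ r ∧ q ≠ r := by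
    have hcard : 2 < (Finset.univ.erase M.start).card := by
      rw [Finset.card_erase_of_mem (Finset.mem_univ _), Finset.card_univ]; omega
    simpa [Finset.mem_erase] using Finset.two_lt_card.1 hcard
  have : Nontrivial σ := ⟨p, q, hpq⟩
  obtain ⟨x₁, x₂, h₁₂, hinj₁, hinj₂⟩ := exists_two_injective_steps hM hp hq hr hpq hpr hqr
  obtain ⟨x₃, p₃, q₃, hne₃, hm₃, hp₃, hq₃⟩ := exists_step_mergesOnly hM hp hpq
  obtain ⟨x₄, p₄, q₄, hne₄, hm₄, -, hq₄⟩ := exists_step_mergesOnly hM hp hp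
  obtain ⟨x₅, c, hconst⟩ := exists_step_const hM
  replace hq₃ : q₃ ≠ M.start := mt hq₃.1 hq
  obtain rfl : q₄ = M.start := hq₄.2 rfl
  have hninj₃ := fun h : Function.Injective (wordMap M [x₃]) => hne₃ (h (hm₃.eq hne₃))
  have hninj₄ := fun h : Function.Injective (wordMap M [x₄]) => hne₄ (h (hm₄.eq hne₄))
  have hninj₅ := fun h : Function.Injective (wordMap M [x₅]) => hpq (h (by rw [hconst]; rfl))
  have h₃₄ : x₃ ≠ x₄ := by
    rintro rfl
    have := (hm₃ _ _ hne₄).1 (hm₄.eq hne₄)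
    grind [Sym2.eq_iff]
  have h₃₅ : x₃ ≠ x₅ := by
    rintro rfl
    have := (hm₃ _ _ hp).1 (by rw [hconst]; rfl)
    grind [Sym2.eq_iff]
  have h₄₅ : x₄ ≠ x₅ := by
    rintro rfl
    have := (hm₄ _ _ hpq).1 (by rw [hconst]; rfl)
    grind [Sym2.eq_iff]
  have hnodup : [x₁, x₂, x₃, x₄, x₅].Nodup := by
    have hne {x y : α} (hx : Function.Injective (wordMap M [x]))
        (hy : ¬ Function.Injective (wordMap M [y])) : x ≠ y := fun h => hy (h ▸ hx)
    simp [h₁₂, h₃₄, h₃₅, h₄₅, hne hinj₁ hninj₃, hne hinj₁ hninj₄, hne hinj₁ hninj₅,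
      hne hinj₂ hninj₃, hne hinj₂ hninj₄, hne hinj₂ hninj₅]
  have := Fintype.ofFinite α
  rw [Nat.card_eq_fintype_card]
  exact hnodup.length_le_card

variable {α : Type} {n : ℕ} {K : Language α}

theorem syntacticSize_le (hn : 4 ≤ n) (hK : K ∈ ofComplexity RegularLeftIdeal n α) :
    K.syntacticSize ≤ ((n ^ (n - 1) + n - 1 : ℕ) : ℕ∞) := by
  obtain ⟨σ, _, M, rfl, hM, rfl, hL⟩ := exists_isMinimal_of_mem_ofComplexity hK
  rw [syntacticSize_accepts hM, ← (Set.toFinite _).cast_ncard_eq, Nat.cast_le]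
  rcases ncard_transitions_lt_or_subset hn hM hL with h | h
  · exact h.le
  · rw [← ncard_fixOrConst M.start]
    exact Set.ncard_le_ncard h (Set.toFinite _)

theorem syntacticSize_lt [Finite α] (hn : 4 ≤ n) (hα : Nat.card α < 5)
    (hK : K ∈ ofComplexity RegularLeftIdeal n α) :
    K.syntacticSize < ((n ^ (n - 1) + n - 1 : ℕ) : ℕ∞) := by
  obtain ⟨σ, _, M, rfl, hM, rfl, hL⟩ := exists_isMinimal_of_mem_ofComplexity hK
  rw [syntacticSize_accepts hM, ← (Set.toFinite _).cast_ncard_eq, Nat.cast_lt]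
  rcases ncard_transitions_lt_or_subset hn hM hL with h | h
  · exact h
  · rw [← ncard_fixOrConst M.start]
    refine Set.ncard_lt_ncard (h.ssubset_of_ne fun heq => ?_) (Set.toFinite _)
    exact absurd (five_le_card heq hn) hα.not_ge

end TransitionSemigroup

section Operations

variable {α : Type*} {L K : Language α}

theorem append_mem (hL : L.IsLeftIdeal) (u : List α) {v : List α} (hv : v ∈ L) : u ++ v ∈ L :=
  le_leftQuotient hL u hv

theorem mem_kstar_iff (hL : L.IsLeftIdeal) {x : List α} : x ∈ L∗ ↔ x = [] ∨ x ∈ L := by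
  constructor
  · rw [mem_kstar]
    rintro ⟨S, rfl, hS⟩
    rcases S.eq_nil_or_concat with rfl | ⟨S, y, rfl⟩
    · exact Or.inl rfl
    · right
      rw [List.concat_eq_append, List.flatten_append, List.flatten_singleton]
      exact append_mem hL _ (hS y (by simp))
  · rintro (rfl | hx)
    · exact nil_mem_kstar L
    · exact (le_kstar : L ≤ L∗) hx

theorem leftQuotient_kstar (hL : L.IsLeftIdeal) {w : List α} (hw : w ≠ []) :
    (L∗).leftQuotient w = L.leftQuotient w := by
  ext x
  rw [mem_leftQuotient, mem_kstar_iff hL, mem_leftQuotient, List.append_eq_nil_iff]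
  simp [hw]

theorem complexity_kstar_le_add_one (hL : L.IsLeftIdeal) :
    (L∗).complexity ≤ L.complexity + 1 := by
  refine le_trans (Set.encard_le_encard ?_) (Set.encard_insert_le L.quotients (L∗))
  rintro _ ⟨w, rfl⟩
  rcases eq_or_ne w [] with rfl | hw
  · exact Set.mem_insert _ _
  · rw [leftQuotient_kstar hL hw]
    exact Or.inr (leftQuotient_mem_quotients L w)

theorem leftQuotient_mul_append (hK : K.IsLeftIdeal) {u v : List α} (hu : u ∈ L)
    (hmin : ∀ s, s <+: u → s ∈ L → s = u) :
    (L * K).leftQuotient (u ++ v) = K.leftQuotient v := by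
  ext x
  rw [mem_leftQuotient, mem_leftQuotient, mem_mul]
  constructor
  · rintro ⟨s, hs, t, ht, hst⟩
    rw [List.append_assoc, List.append_eq_append_iff] at hst
    rcases hst with ⟨y, rfl, rfl⟩ | ⟨y, rfl, h⟩
    · obtain rfl : y = [] := by simpa using hmin s (List.prefix_append _ _) hs
      exact ht
    · rw [h]
      exact append_mem hK y ht
  · intro h
    exact ⟨u, hu, v ++ x, h, (List.append_assoc _ _ _).symm⟩

theorem leftQuotient_mul_of_forall_prefix_notMem (K : Language α) {w : List α}
    (hw : ∀ s, s <+: w → s ∉ L) : (L * K).leftQuotient w = L.leftQuotient w * K := by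
  ext x
  rw [mem_leftQuotient, mem_mul, mem_mul]
  constructor
  · rintro ⟨s, hs, t, ht, hst⟩
    rw [List.append_eq_append_iff] at hst
    rcases hst with ⟨y, rfl, rfl⟩ | ⟨y, rfl, rfl⟩
    · exact absurd hs (hw s (List.prefix_append _ _))
    · exact ⟨y, hs, t, ht, rfl⟩
  · rintro ⟨y, hy, t, ht, rfl⟩
    exact ⟨w ++ y, hy, t, ht, List.append_assoc _ _ _⟩

theorem exists_minimal_prefix_mem {w : List α} (h : ∃ s, s <+: w ∧ s ∈ L) :
    ∃ u v, w = u ++ v ∧ u ∈ L ∧ ∀ s, s <+: u → s ∈ L → s = u := by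
  classical
  have hlength : ∃ k, ∃ s, s <+: w ∧ s ∈ L ∧ s.length = k :=
    let ⟨s, hs, hsL⟩ := h
    ⟨_, s, hs, hsL, rfl⟩
  obtain ⟨u, ⟨v, hv⟩, huL, hu⟩ := Nat.find_spec hlength
  refine ⟨u, v, hv.symm, huL, fun s hs hsL => hs.eq_of_length_le ?_⟩
  rw [hu]
  exact Nat.find_min' hlength ⟨s, hs.trans ⟨v, hv⟩, hsL, rfl⟩

/- After the shortest prefix in `L`, only the remaining suffix matters, because every word of `K`
stays in `K` when a prefix is added. -/
theorem quotients_mul_subset (L : Language α) (hK : K.IsLeftIdeal) :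
    (L * K).quotients ⊆ (· * K) '' {q ∈ L.quotients | [] ∉ q} ∪ K.quotients := by
  rintro _ ⟨w, rfl⟩
  by_cases h : ∃ s, s <+: w ∧ s ∈ L
  · obtain ⟨u, v, rfl, hu, hmin⟩ := exists_minimal_prefix_mem h
    exact Or.inr ⟨v, (leftQuotient_mul_append hK hu hmin).symm⟩
  · push Not at h
    refine Or.inl ⟨L.leftQuotient w, ⟨leftQuotient_mem_quotients L w, ?_⟩,
      (leftQuotient_mul_of_forall_prefix_notMem K h).symm⟩
    rw [mem_leftQuotient, List.append_nil]
    exact h w (List.prefix_refl w)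

theorem complexity_mul_le_sub_one_add (hL : L ≠ 0) (hK : K.IsLeftIdeal) :
    (L * K).complexity ≤ (L.complexity - 1) + K.complexity := by
  obtain ⟨w, hw⟩ : ∃ w, w ∈ L := Set.nonempty_iff_ne_empty.2 hL
  refine (Set.encard_le_encard (quotients_mul_subset L hK)).trans ((Set.encard_union_le _ _).trans
    (add_le_add ((Set.encard_image_le _ _).trans ?_) le_rfl))
  rw [complexity, ← Set.encard_sdiff_singleton_of_mem (leftQuotient_mem_quotients L w)]
  refine Set.encard_le_encard fun q ⟨hq, hnil⟩ => ⟨hq, ?_⟩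
  rintro rfl
  exact hnil (by simpa using hw)

theorem leftQuotient_boolOp (f : Bool → Bool → Bool) (L K : Language α) (w : List α) :
    (boolOp f L K).leftQuotient w = boolOp f (L.leftQuotient w) (K.leftQuotient w) := rfl

theorem complexity_boolOp_le_mul (f : Bool → Bool → Bool) (L K : Language α) :
    (boolOp f L K).complexity ≤ L.complexity * K.complexity := by
  rw [complexity, complexity, complexity, ← Set.encard_prod]
  refine (Set.encard_le_encard ?_).trans (Set.encard_image_le (fun P => boolOp f P.1 P.2) _)
  rintro _ ⟨w, rfl⟩
  exact ⟨(L.leftQuotient w, K.leftQuotient w), ⟨⟨w, rfl⟩, ⟨w, rfl⟩⟩, rfl⟩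

end Operations

section OperationBounds

variable {α : Type} {m n : ℕ} {L K : Language α}

theorem complexity_quotient_le (hK : K ∈ ofComplexity RegularLeftIdeal n α) {q : Language α}
    (hq : q ∈ K.quotients) : q.complexity ≤ (n : ℕ∞) :=
  hK.2 ▸ complexity_le_of_mem_quotients hq

theorem complexity_kstar_le (hK : K ∈ ofComplexity RegularLeftIdeal n α) :
    (K∗).complexity ≤ ((n + 1 : ℕ) : ℕ∞) := by
  have h := complexity_kstar_le_add_one hK.1.2
  rw [hK.2] at h
  exact_mod_cast h

theorem complexity_mul_le (hL : L ∈ ofComplexity RegularLeftIdeal m α)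
    (hK : K ∈ ofComplexity RegularLeftIdeal n α) :
    (L * K).complexity ≤ ((m + n - 1 : ℕ) : ℕ∞) := by
  have hm : m ≠ 0 := by
    rintro rfl
    exact Set.encard_ne_zero_of_mem (self_mem_quotients L) hL.2
  have h := complexity_mul_le_sub_one_add hL.1.2.1 hK.1.2
  rw [hL.2, hK.2] at h
  rw [show m + n - 1 = (m - 1) + n by omega]
  exact_mod_cast h

theorem complexity_boolOp_le (f : Bool → Bool → Bool)
    (hL : L ∈ ofComplexity RegularLeftIdeal m α) (hK : K ∈ ofComplexity RegularLeftIdeal n α) :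
    (boolOp f L K).complexity ≤ ((m * n : ℕ) : ℕ∞) := by
  have h := complexity_boolOp_le_mul f L K
  rw [hL.2, hK.2] at h
  exact_mod_cast h

end OperationBounds

section AtomCount

variable {α σ : Type*} {M : DFA α σ}

theorem ncard_setOf_notMem [Fintype σ] (z : σ) :
    {S : Set σ | z ∉ S}.ncard = 2 ^ (Fintype.card σ - 1) := by
  have hpowerset : {S : Set σ | z ∉ S} = 𝒫 {z}ᶜ := by
    ext S
    simp [Set.subset_compl_singleton_iff]
  rw [hpowerset, Set.ncard_powerset, Set.ncard_compl, Set.ncard_singleton,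
    Nat.card_eq_fintype_card]

theorem ncard_setOf_notMem_or_univ [Fintype σ] (z : σ) :
    {S : Set σ | z ∉ S ∨ S = Set.univ}.ncard = 2 ^ (Fintype.card σ - 1) + 1 := by
  have hinsert : {S : Set σ | z ∉ S ∨ S = Set.univ} = insert Set.univ {S : Set σ | z ∉ S} := by
    ext S
    simp [or_comm]
  rw [hinsert, Set.ncard_insert_of_notMem (by simp), ncard_setOf_notMem]

theorem start_notMem_or_eq_univ (hM : M.IsMinimal) (hL : M.accepts.IsLeftIdeal) (x : List α) :
    M.start ∉ acceptingStates M x ∨ acceptingStates M x = Set.univ :=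
  or_iff_not_imp_left.2 fun h => Set.eq_univ_of_forall fun q =>
    acceptsFrom_start_le hM hL q (not_not.1 h)

theorem encard_atoms_le {α : Type} {n : ℕ} {K : Language α}
    (hK : K ∈ ofComplexity RegularLeftIdeal n α) :
    K.atoms.encard ≤ ((2 ^ (n - 1) + 1 : ℕ) : ℕ∞) := by
  obtain ⟨σ, _, M, rfl, hM, rfl, hL⟩ := exists_isMinimal_of_mem_ofComplexity hK
  rw [encard_atoms_accepts hM, ← ncard_setOf_notMem_or_univ M.start,
    (Set.toFinite _).cast_ncard_eq]
  refine Set.encard_le_encard ?_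
  rintro _ ⟨x, rfl⟩
  exact start_notMem_or_eq_univ hM hL x

end AtomCount

section AtomPairs

variable {σ : Type*} [Fintype σ]

/-- The pairs `(X, Y)` of sets of states that index the non-empty quotients of the atom `A_S` of a
left ideal with initial state `z`, where `S` is a non-empty set of `s` non-initial states and is not
the set of all of them. -/
def atomPairs (z : σ) (s : ℕ) : Set (Set σ × Set σ) :=
  {P | P.1.Nonempty ∧ z ∈ P.2 ∧ Disjoint P.1 P.2 ∧ P.1.ncard ≤ s ∧
    P.2.ncard ≤ Fintype.card σ - s}

theorem card_filter_mem_disjoint [DecidableEq σ] {z : σ} {X : Finset σ} (hz : z ∉ X) {y : ℕ}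
    (hy : 1 ≤ y) :
    ({Y | z ∈ Y ∧ Disjoint X Y ∧ Y.card = y} : Finset (Finset σ)).card =
      (Fintype.card σ - X.card - 1).choose (y - 1) := by
  have himage : ({Y | z ∈ Y ∧ Disjoint X Y ∧ Y.card = y} : Finset (Finset σ)) =
      ((insert z X)ᶜ.powersetCard (y - 1)).image (insert z) := by
    ext Y
    simp only [Finset.mem_filter_univ, Finset.mem_image, Finset.mem_powersetCard,
      Finset.subset_compl_iff_disjoint_left, Finset.disjoint_insert_left]
    constructor
    · rintro ⟨hzY, hXY, rfl⟩
      exact ⟨Y.erase z, ⟨⟨Finset.notMem_erase z Y, hXY.mono_right (Finset.erase_subset z Y)⟩,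
        Finset.card_erase_of_mem hzY⟩, Finset.insert_erase hzY⟩
    · rintro ⟨Z, ⟨⟨hzZ, hXZ⟩, hZ⟩, rfl⟩
      refine ⟨Finset.mem_insert_self z Z, Finset.disjoint_insert_right.2 ⟨hz, hXZ⟩, ?_⟩
      rw [Finset.card_insert_of_notMem hzZ]
      omega
  have hinj : Set.InjOn (insert z) ((insert z X)ᶜ.powersetCard (y - 1) : Set (Finset σ)) := by
    intro Y hY Z hZ h
    have hnotMem {W : Finset σ} (hW : W ∈ (insert z X)ᶜ.powersetCard (y - 1)) : z ∉ W :=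
      fun hzW => Finset.mem_compl.1 ((Finset.mem_powersetCard.1 hW).1 hzW)
        (Finset.mem_insert_self z X)
    rw [← Finset.erase_insert (hnotMem hY), ← Finset.erase_insert (hnotMem hZ), h]
  rw [himage, Finset.card_image_of_injOn hinj, Finset.card_powersetCard, Finset.card_compl,
    Finset.card_insert_of_notMem hz, Nat.sub_add_eq]

theorem card_filter_disjoint_pairs [DecidableEq σ] (z : σ) (x : ℕ) {y : ℕ} (hy : 1 ≤ y) :
    ({P | z ∈ P.2 ∧ Disjoint P.1 P.2 ∧ P.1.card = x ∧ P.2.card = y} :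
        Finset (Finset σ × Finset σ)).card =
      (Fintype.card σ - 1).choose x * (Fintype.card σ - x - 1).choose (y - 1) := by
  have hcard : (Finset.powersetCard x {z}ᶜ).card = (Fintype.card σ - 1).choose x := by
    rw [Finset.card_powersetCard, Finset.card_compl, Finset.card_singleton]
  rw [Finset.card_eq_sum_card_fiberwise (f := Prod.fst) (t := Finset.powersetCard x {z}ᶜ), ← hcard,
    ← smul_eq_mul, ← Finset.sum_const]
  · refine Finset.sum_congr rfl fun X hX => ?_
    rw [Finset.mem_powersetCard, Finset.subset_compl_singleton] at hX
    obtain ⟨hz, rfl⟩ := hX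
    rw [← card_filter_mem_disjoint hz hy]
    refine Finset.card_nbij' Prod.snd (fun Y => (X, Y)) ?_ ?_ ?_ ?_ <;>
      simp only [Set.MapsTo, Set.LeftInvOn, Prod.forall] <;> grind
  · rintro ⟨X, Y⟩ hP
    simp only [Finset.coe_filter_univ, Set.mem_ofPred_eq] at hP
    obtain ⟨hzY, hdisjoint, hX, -⟩ := hP
    rw [Finset.mem_coe, Finset.mem_powersetCard, Finset.subset_compl_singleton]
    exact ⟨fun hzX => Finset.disjoint_left.1 hdisjoint hzX hzY, hX⟩

theorem ncard_atomPairs (z : σ) (s : ℕ) :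
    (atomPairs z s).ncard = ∑ x ∈ Finset.Icc 1 s, ∑ y ∈ Finset.Icc 1 (Fintype.card σ - s),
      (Fintype.card σ - 1).choose x * (Fintype.card σ - x - 1).choose (y - 1) := by
  classical
  let e := (Fintype.finsetEquivSet (α := σ)).prodCongr (Fintype.finsetEquivSet (α := σ))
  have hpreimage : e ⁻¹' atomPairs z s = ({P | P.1.Nonempty ∧ z ∈ P.2 ∧ Disjoint P.1 P.2 ∧
      P.1.card ≤ s ∧ P.2.card ≤ Fintype.card σ - s} : Finset (Finset σ × Finset σ)) := by
    ext ⟨X, Y⟩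
    simp [e, atomPairs]
  rw [← Set.ncard_preimage_of_injective_subset_range e.injective (by simp), hpreimage,
    Set.ncard_coe_finset, Finset.card_eq_sum_card_fiberwise
      (f := fun P => (P.1.card, P.2.card)) (t := Finset.Icc 1 s ×ˢ Finset.Icc 1 _),
    Finset.sum_product]
  · refine Finset.sum_congr rfl fun x hx => Finset.sum_congr rfl fun y hy => ?_
    rw [Finset.mem_Icc] at hx hy
    rw [← card_filter_disjoint_pairs z x hy.1, Finset.filter_filter]
    congr 1
    ext ⟨X, Y⟩
    grind [Finset.card_pos]
  · rintro ⟨X, Y⟩ hP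
    simp only [Finset.coe_filter_univ, Set.mem_ofPred_eq] at hP
    obtain ⟨hX, hz, -, hXs, hYs⟩ := hP
    simpa [hXs, hYs] using ⟨hX, (⟨z, hz⟩ : Y.Nonempty)⟩

end AtomPairs

section AtomBound

theorem atomBound_self (n : ℕ) : atomBound n n = n := by simp [atomBound]

theorem atomBound_zero {n : ℕ} (hn : n ≠ 0) : atomBound n 0 = 2 ^ (n - 1) := by
  simp [atomBound, hn.symm]

theorem atomBound_pred {n : ℕ} (hn : 2 ≤ n) : atomBound n (n - 1) = 2 ^ (n - 1) := by
  rw [atomBound, if_neg (by omega), if_neg (by omega), show n - (n - 1) = 1 by omega]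
  simp only [Finset.Icc_self, Finset.sum_singleton, Nat.sub_self, Nat.choose_zero_right, mul_one]
  rw [← Nat.sum_range_choose, Finset.range_eq_Ico, Finset.sum_eq_sum_Ico_succ_bot (by omega),
    Nat.choose_zero_right]
  rfl

theorem atomBound_eq_ncard {σ : Type*} [Fintype σ] (z : σ) {s : ℕ} (hs : s ≠ 0)
    (hs' : s ≠ Fintype.card σ) : atomBound (Fintype.card σ) s = (atomPairs z s).ncard + 1 := by
  rw [atomBound, if_neg hs', if_neg hs, ncard_atomPairs, add_comm]

end AtomBound

section AtomUpperBound

variable {α σ : Type*} {M : DFA α σ}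

theorem cell_eq_zero (M : DFA α σ) {X Y : Set σ} (h : ¬Disjoint X Y) : cell M X Y = 0 := by
  ext y
  rw [mem_cell]
  exact iff_of_false (fun ⟨hX, hY⟩ => h (hY.symm.mono_left hX)) (notMem_zero y)

theorem disjoint_acceptingStates_mono {Y Y' : Set σ} {x : List α}
    (h : ∀ q ∈ Y, ∃ q' ∈ Y', M.acceptsFrom q ≤ M.acceptsFrom q')
    (hx : Disjoint Y' (acceptingStates M x)) : Disjoint Y (acceptingStates M x) := by
  rw [Set.disjoint_left] at hx ⊢
  intro q hq hqx
  obtain ⟨q', hq', hle⟩ := h q hq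
  exact hx hq' (hle hqx)

theorem cell_congr_right (X : Set σ) {Y Y' : Set σ}
    (h : ∀ q ∈ Y, ∃ q' ∈ Y', M.acceptsFrom q ≤ M.acceptsFrom q')
    (h' : ∀ q ∈ Y', ∃ q' ∈ Y, M.acceptsFrom q ≤ M.acceptsFrom q') : cell M X Y = cell M X Y' := by
  ext x
  exact and_congr_right fun _ =>
    ⟨disjoint_acceptingStates_mono h', disjoint_acceptingStates_mono h⟩

theorem cell_congr_left {X X' : Set σ} (Y : Set σ) (h : X' ⊆ X)
    (h' : ∀ q ∈ X, ∃ q' ∈ X', M.acceptsFrom q' ≤ M.acceptsFrom q) : cell M X Y = cell M X' Y := by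
  ext x
  refine and_congr_left fun _ => ⟨h.trans, fun hx q hq => ?_⟩
  obtain ⟨q', hq', hle⟩ := h' q hq
  exact hle (hx hq')

theorem cell_insert_start (hM : M.IsMinimal) (hL : M.accepts.IsLeftIdeal) (X : Set σ) {Y : Set σ}
    (hY : Y.Nonempty) : cell M X (insert M.start Y) = cell M X Y := by
  obtain ⟨r, hr⟩ := hY
  refine cell_congr_right X ?_ fun q hq => ⟨q, Or.inr hq, le_rfl⟩
  rintro q (rfl | hq)
  · exact ⟨r, hr, acceptsFrom_start_le hM hL r⟩
  · exact ⟨q, hq, le_rfl⟩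

theorem cell_univ_compl (hM : M.IsMinimal) (hL : M.accepts.IsLeftIdeal) :
    cell M Set.univ Set.univᶜ = M.accepts := by
  ext x
  rw [mem_cell_compl, Set.eq_univ_iff_forall]
  exact ⟨fun h => h M.start, fun h q => acceptsFrom_start_le hM hL q h⟩

theorem encard_le_ncard_of_subset_image {β γ : Type*} (f : β → γ) {s : Set β} (hs : s.Finite)
    {t : Set γ} (h : t ⊆ f '' s) : t.encard ≤ (s.ncard : ℕ∞) := by
  rw [hs.cast_ncard_eq]
  exact (Set.encard_le_encard h).trans (Set.encard_image_le _ _)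

theorem acceptsFrom_wordMap_start_le (hM : M.IsMinimal) (hL : M.accepts.IsLeftIdeal) (w : List α)
    (q : σ) : M.acceptsFrom (wordMap M w M.start) ≤ M.acceptsFrom (wordMap M w q) :=
  acceptsFrom_wordMap_mono (acceptsFrom_start_le hM hL q) w

/-- The elements of `Z` that accept the least language, or the empty set if `Z` has at most one
element. -/
def leastStates (M : DFA α σ) (Z : Set σ) : Set σ :=
  {r ∈ Z | Z.Nontrivial ∧ ∀ q ∈ Z, M.acceptsFrom r ≤ M.acceptsFrom q}

open scoped Classical in
/-- The quotients of the atom `A_S` of a left ideal, where `S` consists of all non-initial states,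
as a function on the sets of non-initial states. Such a quotient is the cell of some `X` and `{r}`
with `r` below `X`. If `r` is not initial, it is encoded by `insert r X`, which determines `r` as
its least state. -/
noncomputable def coatomCell (M : DFA α σ) (Z : Set σ) : Language α :=
  if Z = ∅ then 0 else cell M (Z \ leastStates M Z) (insert M.start (leastStates M Z))

theorem leastStates_insert (hM : M.IsMinimal) {X : Set σ} {r : σ} (hX : X.Nonempty) (hr : r ∉ X)
    (hle : ∀ q ∈ X, M.acceptsFrom r ≤ M.acceptsFrom q) : leastStates M (insert r X) = {r} := by
  obtain ⟨q, hq⟩ := hX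
  refine Set.eq_singleton_iff_unique_mem.2 ⟨⟨Set.mem_insert r X, ?_, ?_⟩, ?_⟩
  · exact ⟨r, Set.mem_insert r X, q, Or.inr hq, (ne_of_mem_of_not_mem hq hr).symm⟩
  · rintro p (rfl | hp)
    exacts [le_rfl, hle p hp]
  · rintro p ⟨rfl | hp, -, hmin⟩
    · rfl
    · exact acceptsFrom_injective hM (le_antisymm (hmin r (Set.mem_insert r X)) (hle p hp))

theorem exists_coatomCell_eq_cell_start {X : Set σ} (hX : X.Nonempty) (hz : M.start ∉ X) :
    ∃ Z, M.start ∉ Z ∧ coatomCell M Z = cell M X {M.start} := by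
  by_cases h : ∃ r ∈ X, ∀ q ∈ X, M.acceptsFrom r ≤ M.acceptsFrom q
  · obtain ⟨r, hr, hle⟩ := h
    have hleast : leastStates M {r} = ∅ := by simp [leastStates]
    refine ⟨{r}, fun h => hz (Set.mem_singleton_iff.1 h ▸ hr), ?_⟩
    rw [coatomCell, if_neg (Set.singleton_ne_empty r), hleast, Set.sdiff_empty, insert_empty_eq]
    exact (cell_congr_left _ (Set.singleton_subset_iff.2 hr) fun q hq => ⟨r, rfl, hle q hq⟩).symm
  · have hleast : leastStates M X = ∅ :=
      Set.eq_empty_of_forall_notMem fun r hr => h ⟨r, hr.1, hr.2.2⟩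
    refine ⟨X, hz, ?_⟩
    rw [coatomCell, if_neg hX.ne_empty, hleast, Set.sdiff_empty, insert_empty_eq]

theorem exists_coatomCell_eq_cell (hM : M.IsMinimal) (hL : M.accepts.IsLeftIdeal) {X : Set σ}
    {r : σ} (hX : X.Nonempty) (hle : ∀ q ∈ X, M.acceptsFrom r ≤ M.acceptsFrom q) :
    ∃ Z, M.start ∉ Z ∧ coatomCell M Z = cell M X {r} := by
  by_cases hr : r ∈ X
  · refine ⟨∅, Set.notMem_empty _, ?_⟩
    rw [coatomCell, if_pos rfl, cell_eq_zero M (by simpa using hr)]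
  rcases eq_or_ne r M.start with rfl | hstart
  · exact exists_coatomCell_eq_cell_start hX hr
  · have hz : M.start ∉ insert r X := by
      rintro (h | h)
      · exact hstart h.symm
      · exact hstart (acceptsFrom_injective hM
          (le_antisymm (hle _ h) (acceptsFrom_start_le hM hL r)))
    refine ⟨insert r X, hz, ?_⟩
    rw [coatomCell, if_neg (Set.insert_nonempty r X).ne_empty, leastStates_insert hM hX hr hle,
      Set.insert_sdiff_self_of_notMem hr, cell_insert_start hM hL X (Set.singleton_nonempty r)]

variable [Fintype σ]

theorem complexity_cell_empty_univ_le (hM : M.IsMinimal) (hL : M.accepts.IsLeftIdeal) :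
    (cell M ∅ Set.univ).complexity ≤ ((2 ^ (Fintype.card σ - 1) : ℕ) : ℕ∞) := by
  rw [← ncard_setOf_notMem M.start, complexity, quotients_cell]
  refine encard_le_ncard_of_subset_image (fun Y => cell M ∅ (insert M.start Y))
    (Set.toFinite _) ?_
  rintro _ ⟨w, rfl⟩
  refine ⟨wordMap M w '' Set.univ \ {M.start}, fun h => h.2 rfl, ?_⟩
  simp only [Set.insert_sdiff_singleton, Set.image_empty]
  exact cell_insert_start hM hL ∅ ⟨_, M.start, trivial, rfl⟩

/- The cell does not change when the initial state is added to `Y`, nor when the least state `r` is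
removed from `Y` while another state remains; doing both keeps `Y` within the required size. -/
theorem exists_mem_atomPairs_cell_eq (hM : M.IsMinimal) (hL : M.accepts.IsLeftIdeal)
    {X Y : Set σ} {r : σ} {s : ℕ} (hX : X.Nonempty) (hXY : Disjoint X Y) (hr : r ∈ Y)
    (hle : ∀ q, q ∈ X ∪ Y → M.acceptsFrom r ≤ M.acceptsFrom q) (hXs : X.ncard ≤ s)
    (hYs : Y.ncard ≤ Fintype.card σ - s) (hs : s + 2 ≤ Fintype.card σ) :
    ∃ P ∈ atomPairs M.start s, cell M P.1 P.2 = cell M X Y := by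
  have hstart : M.start ∉ X := fun hzX => by
    obtain rfl : r = M.start := acceptsFrom_injective hM
      (le_antisymm (hle _ (Or.inl hzX)) (acceptsFrom_start_le hM hL r))
    exact Set.disjoint_left.1 hXY hzX hr
  have hmem {Y' : Set σ} (hY' : Y' ⊆ Y) (hcard : (insert M.start Y').ncard ≤ Fintype.card σ - s) :
      (X, insert M.start Y') ∈ atomPairs M.start s :=
    ⟨hX, Set.mem_insert _ _, Set.disjoint_insert_right.2 ⟨hstart, hXY.mono_right hY'⟩, hXs, hcard⟩
  by_cases hYr : (Y \ {r}).Nonempty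
  · refine ⟨_, hmem (Set.sdiff_subset : Y \ {r} ⊆ Y) ?_, ?_⟩
    · have hpos : 0 < Y.ncard := (Set.ncard_pos (Set.toFinite _)).2 ⟨r, hr⟩
      have hinsert := Set.ncard_insert_le M.start (Y \ {r})
      rw [Set.ncard_sdiff_singleton_of_mem hr] at hinsert
      omega
    · rw [cell_insert_start hM hL X hYr]
      obtain ⟨q', hq', hqr'⟩ := hYr
      refine cell_congr_right X (fun q hq => ⟨q, hq.1, le_rfl⟩) fun q hq => ?_
      rcases eq_or_ne q r with rfl | hqr
      · exact ⟨q', ⟨hq', hqr'⟩, hle q' (Or.inr hq')⟩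
      · exact ⟨q, ⟨hq, hqr⟩, le_rfl⟩
  · obtain rfl : Y = {r} := by
      rw [Set.not_nonempty_iff_eq_empty, Set.sdiff_eq_empty] at hYr
      exact hYr.antisymm (Set.singleton_subset_iff.2 hr)
    refine ⟨_, hmem subset_rfl ((Set.ncard_insert_le _ _).trans ?_),
      cell_insert_start hM hL X ⟨r, hr⟩⟩
    rw [Set.ncard_singleton]
    omega

theorem quotients_cell_subset (hM : M.IsMinimal) (hL : M.accepts.IsLeftIdeal) {S : Set σ}
    (hS : S.Nonempty) (hz : M.start ∉ S) (hcard : S.ncard + 2 ≤ Fintype.card σ) :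
    (cell M S Sᶜ).quotients ⊆
      insert 0 ((fun P => cell M P.1 P.2) '' atomPairs M.start S.ncard) := by
  rw [quotients_cell]
  rintro _ ⟨w, rfl⟩
  by_cases hdisjoint : Disjoint (wordMap M w '' S) (wordMap M w '' Sᶜ)
  · refine Or.inr (exists_mem_atomPairs_cell_eq hM hL (hS.image _) hdisjoint ⟨_, hz, rfl⟩ ?_
      (Set.ncard_image_le (Set.toFinite _)) ?_ hcard)
    · rintro _ (⟨q, -, rfl⟩ | ⟨q, -, rfl⟩) <;> exact acceptsFrom_wordMap_start_le hM hL w q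
    · refine (Set.ncard_image_le (Set.toFinite _)).trans_eq ?_
      rw [Set.ncard_compl, Nat.card_eq_fintype_card]
  · exact Or.inl (cell_eq_zero M hdisjoint)

theorem complexity_cell_compl_start_le (hM : M.IsMinimal) (hL : M.accepts.IsLeftIdeal)
    (hσ : 2 ≤ Fintype.card σ) :
    (cell M {M.start}ᶜ {M.start}).complexity ≤ ((2 ^ (Fintype.card σ - 1) : ℕ) : ℕ∞) := by
  have : Nontrivial σ := Fintype.one_lt_card_iff_nontrivial.1 hσ
  rw [← ncard_setOf_notMem M.start, complexity, quotients_cell]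
  refine encard_le_ncard_of_subset_image (coatomCell M) (Set.toFinite _) ?_
  rintro _ ⟨w, rfl⟩
  simp only [Set.image_singleton]
  have hne : ({M.start}ᶜ : Set σ).Nonempty := exists_ne M.start
  refine exists_coatomCell_eq_cell hM hL (hne.image _) ?_
  rintro _ ⟨q, -, rfl⟩
  exact acceptsFrom_wordMap_start_le hM hL w q

theorem complexity_cell_le (hM : M.IsMinimal) (hL : M.accepts.IsLeftIdeal)
    (hσ : 2 ≤ Fintype.card σ) {S : Set σ} (hS : M.start ∉ S ∨ S = Set.univ) :
    (cell M S Sᶜ).complexity ≤ (atomBound (Fintype.card σ) S.ncard : ℕ∞) := by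
  rcases hS with hz | rfl
  swap
  · rw [cell_univ_compl hM hL, complexity_accepts hM, Set.ncard_univ, Nat.card_eq_fintype_card,
      atomBound_self, ENat.card_eq_coe_fintype_card]
  rcases S.eq_empty_or_nonempty with rfl | hS
  · rw [Set.ncard_empty, atomBound_zero (by omega), Set.compl_empty]
    exact complexity_cell_empty_univ_le hM hL
  have hsubset : S ⊆ {M.start}ᶜ := Set.subset_compl_singleton_iff.2 hz
  have hcompl : ({M.start}ᶜ : Set σ).ncard = Fintype.card σ - 1 := by
    rw [Set.ncard_compl, Set.ncard_singleton, Nat.card_eq_fintype_card]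
  rcases hsubset.eq_or_ssubset with h | hssubset
  · rw [h, hcompl, atomBound_pred hσ, compl_compl ({M.start} : Set σ)]
    exact complexity_cell_compl_start_le hM hL hσ
  · have hlt := Set.ncard_lt_ncard hssubset (Set.toFinite _)
    rw [atomBound_eq_ncard M.start ((Set.ncard_pos (Set.toFinite _)).2 hS).ne' (by omega)]
    refine (Set.encard_le_encard (quotients_cell_subset hM hL hS hz (by omega))).trans
      ((Set.encard_insert_le _ _).trans ?_)
    rw [Nat.cast_add, Nat.cast_one]
    exact add_le_add (encard_le_ncard_of_subset_image _ (Set.toFinite _) subset_rfl) le_rfl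

theorem complexity_atom_le {α : Type} {n : ℕ} (hn : 2 ≤ n) {K : Language α}
    (hK : K ∈ ofComplexity RegularLeftIdeal n α) {A : Language α} (hA : A ∈ K.atoms) :
    A.complexity ≤ (atomBound n (K.atomIndex A).ncard : ℕ∞) := by
  obtain ⟨σ, _, M, rfl, hM, rfl, hL⟩ := exists_isMinimal_of_mem_ofComplexity hK
  rw [atoms_eq_range_atomOf] at hA
  obtain ⟨x, rfl⟩ := hA
  rw [ncard_atomIndex_atomOf hM, atomOf_accepts hM]
  exact complexity_cell_le hM hL hn (start_notMem_or_eq_univ hM hL x)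

end AtomUpperBound

section AtomLowerBound

theorem exists_image_eq_of_ncard_le {σ : Type*} [Finite σ] {S X : Set σ} (hX : X.Nonempty)
    (h : X.ncard ≤ S.ncard) : ∃ g : σ → σ, g '' S = X := by
  have := Fintype.ofFinite σ
  have : Nonempty X := hX.to_subtype
  obtain ⟨i⟩ : Nonempty (X ↪ S) := by
    classical
    refine Function.Embedding.nonempty_of_card_le ?_
    rwa [← Nat.card_eq_fintype_card, ← Nat.card_eq_fintype_card, Nat.card_coe_set_eq,
      Nat.card_coe_set_eq]
  have hi : Function.Injective fun x => (i x : σ) := Subtype.val_injective.comp i.injective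
  refine ⟨fun q => (Function.invFun (fun x => (i x : σ)) q : X), Set.Subset.antisymm ?_ ?_⟩
  · rintro _ ⟨q, -, rfl⟩
    exact Subtype.prop _
  · exact fun x hx =>
      ⟨i ⟨x, hx⟩, Subtype.prop _, congrArg Subtype.val (Function.leftInverse_invFun hi ⟨x, hx⟩)⟩

theorem exists_image_eq_of_ncard_le_of_mem {σ : Type*} [Finite σ] {S X : Set σ} {z : σ}
    (hzS : z ∈ S) (hzX : z ∈ X) (h : X.ncard ≤ S.ncard) :
    ∃ g : σ → σ, g z = z ∧ g '' S = X := by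
  classical
  obtain ⟨g, rfl⟩ := exists_image_eq_of_ncard_le ⟨z, hzX⟩ h
  obtain ⟨q, hq, hqz⟩ := hzX
  have hswap : Equiv.swap z q '' S = S := by
    refine Set.eq_of_subset_of_ncard_le ?_ (Set.ncard_image_of_injective S (Equiv.injective _)).ge
    rintro _ ⟨p, hp, rfl⟩
    rw [Equiv.swap_apply_def]
    split_ifs
    exacts [hq, hzS, hp]
  refine ⟨g ∘ Equiv.swap z q, ?_, ?_⟩
  · rw [Function.comp_apply, Equiv.swap_apply_left, hqz]
  · rw [Set.image_comp, hswap]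

variable {α σ : Type*} {M : DFA α σ}

theorem cell_image_mem_quotients (S : Set σ) {t : σ → σ} (ht : t ∈ transitions M) :
    cell M (t '' S) (t '' Sᶜ) ∈ (cell M S Sᶜ).quotients := by
  obtain ⟨w, -, rfl⟩ := ht
  rw [quotients_cell]
  exact ⟨w, rfl⟩

theorem cell_le_cell_iff (hS : ∀ S : Set σ, M.start ∉ S → ∃ x, acceptingStates M x = S)
    {X Y X' Y' : Set σ} (hXY : Disjoint X Y) (hz : M.start ∈ Y) :
    cell M X Y ≤ cell M X' Y' ↔ X' ⊆ X ∧ Y' ⊆ Y := by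
  refine ⟨fun h => ⟨?_, ?_⟩, fun h x hx => ⟨h.1.trans hx.1, hx.2.mono_left h.2⟩⟩
  · obtain ⟨x, rfl⟩ := hS X fun hzX => Set.disjoint_left.1 hXY hzX hz
    exact (h ⟨subset_rfl, hXY.symm⟩ : x ∈ cell M X' Y').1
  · obtain ⟨x, hx⟩ := hS Yᶜ fun h => h hz
    have hmem : x ∈ cell M X Y := by
      rw [mem_cell, hx]
      exact ⟨Set.subset_compl_iff_disjoint_right.2 hXY, disjoint_compl_right⟩
    have hdisjoint := (h hmem).2
    rwa [hx, Set.disjoint_compl_right_iff_subset] at hdisjoint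

theorem cell_injOn (hS : ∀ S : Set σ, M.start ∉ S → ∃ x, acceptingStates M x = S) :
    Set.InjOn (fun P : Set σ × Set σ => cell M P.1 P.2) {P | Disjoint P.1 P.2 ∧ M.start ∈ P.2} := by
  rintro ⟨X, Y⟩ ⟨hXY, hz⟩ ⟨X', Y'⟩ ⟨hXY', hz'⟩ h
  have hle := (cell_le_cell_iff hS hXY hz).1 (le_of_eq h)
  have hge := (cell_le_cell_iff hS hXY' hz').1 (le_of_eq h.symm)
  exact Prod.ext (hge.1.antisymm hle.1) (hge.2.antisymm hle.2)

theorem cell_ne_zero (hS : ∀ S : Set σ, M.start ∉ S → ∃ x, acceptingStates M x = S)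
    {X Y : Set σ} (hXY : Disjoint X Y) (hz : M.start ∈ Y) : cell M X Y ≠ 0 := by
  obtain ⟨x, rfl⟩ := hS X fun hzX => Set.disjoint_left.1 hXY hzX hz
  exact Set.Nonempty.ne_empty ⟨x, subset_rfl, hXY.symm⟩

variable [Fintype σ]

theorem le_complexity_cell_empty_univ (hT : fixOrConst M.start ⊆ transitions M)
    (hS : ∀ S : Set σ, M.start ∉ S → ∃ x, acceptingStates M x = S) :
    ((2 ^ (Fintype.card σ - 1) : ℕ) : ℕ∞) ≤ (cell M ∅ Set.univ).complexity := by
  classical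
  have hinj : Set.InjOn (fun Z : Set σ => cell M ∅ Zᶜ) {Z | M.start ∉ Z} := by
    intro Z hZ Z' hZ' h
    have hpair : ((∅, Zᶜ) : Set σ × Set σ) = (∅, Z'ᶜ) :=
      cell_injOn hS ⟨Set.empty_disjoint _, hZ⟩ ⟨Set.empty_disjoint _, hZ'⟩ h
    exact compl_injective (Prod.ext_iff.1 hpair).2
  rw [← ncard_setOf_notMem M.start, (Set.toFinite _).cast_ncard_eq, ← hinj.encard_image]
  refine Set.encard_le_encard ?_
  rintro _ ⟨Z, hZ, rfl⟩
  have ht : (fun q => if q ∈ Z then M.start else q) ∈ fixOrConst M.start := Or.inl (if_neg hZ)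
  have hmem := cell_image_mem_quotients ∅ (hT ht)
  have himage : (fun q => if q ∈ Z then M.start else q) '' Set.univ = Zᶜ := by
    ext q
    constructor
    · rintro ⟨p, -, rfl⟩
      by_cases hp : p ∈ Z <;> simp_all
    · exact fun hq => ⟨q, trivial, if_neg hq⟩
  rwa [Set.image_empty, Set.compl_empty, himage] at hmem

theorem cell_mem_quotients_of_mem_atomPairs (hT : fixOrConst M.start ⊆ transitions M) {S : Set σ}
    (hz : M.start ∉ S) {P : Set σ × Set σ} (hP : P ∈ atomPairs M.start S.ncard) :
    cell M P.1 P.2 ∈ (cell M S Sᶜ).quotients := by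
  classical
  obtain ⟨hX, hzY, -, hXS, hYS⟩ := hP
  rw [← Nat.card_eq_fintype_card, ← Set.ncard_compl] at hYS
  obtain ⟨g, hg⟩ := exists_image_eq_of_ncard_le hX hXS
  obtain ⟨g', hgz, hg'⟩ := exists_image_eq_of_ncard_le_of_mem hz hzY hYS
  have ht : (fun q => if q ∈ S then g q else g' q) ∈ fixOrConst M.start :=
    Or.inl ((if_neg hz).trans hgz)
  have hmem := cell_image_mem_quotients S (hT ht)
  have hcompl : (fun q => if q ∈ S then g q else g' q) '' Sᶜ = g' '' Sᶜ :=
    Set.image_congr fun _ hq => if_neg hq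
  rwa [Set.image_congr fun q hq => if_pos hq, hg, hcompl, hg'] at hmem

theorem le_complexity_cell (hT : fixOrConst M.start ⊆ transitions M)
    (hS : ∀ S : Set σ, M.start ∉ S → ∃ x, acceptingStates M x = S) {S : Set σ}
    (hne : S.Nonempty) (hz : M.start ∉ S) :
    (((atomPairs M.start S.ncard).ncard + 1 : ℕ) : ℕ∞) ≤ (cell M S Sᶜ).complexity := by
  have hinj : Set.InjOn (fun P : Set σ × Set σ => cell M P.1 P.2) (atomPairs M.start S.ncard) :=
    (cell_injOn hS).mono fun _ hP => And.intro hP.2.2.1 hP.2.1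
  have hzero : (0 : Language α) ∉
      (fun P : Set σ × Set σ => cell M P.1 P.2) '' atomPairs M.start S.ncard := by
    rintro ⟨P, ⟨-, hzP, hdisjoint, -⟩, h⟩
    exact cell_ne_zero hS hdisjoint hzP h
  rw [Nat.cast_add, Nat.cast_one, (Set.toFinite _).cast_ncard_eq, ← hinj.encard_image,
    ← Set.encard_insert_of_notMem hzero]
  refine Set.encard_le_encard (Set.insert_subset ?_ ?_)
  · have ht : (fun _ => M.start) ∈ fixOrConst M.start := Or.inl rfl
    have hmem := cell_image_mem_quotients S (hT ht)
    have hne' : Sᶜ.Nonempty := ⟨M.start, hz⟩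
    rwa [hne.image_const, hne'.image_const,
      cell_eq_zero M (X := {M.start}) (by simp)] at hmem
  · rintro _ ⟨P, hP, rfl⟩
    exact cell_mem_quotients_of_mem_atomPairs hT hz hP

theorem complexity_cell_eq (hM : M.IsMinimal) (hL : M.accepts.IsLeftIdeal)
    (hσ : 2 ≤ Fintype.card σ) (hT : fixOrConst M.start ⊆ transitions M)
    (hS : ∀ S : Set σ, M.start ∉ S → ∃ x, acceptingStates M x = S) {S : Set σ}
    (h : M.start ∉ S ∨ S = Set.univ) :
    (cell M S Sᶜ).complexity = (atomBound (Fintype.card σ) S.ncard : ℕ∞) := by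
  refine le_antisymm (complexity_cell_le hM hL hσ h) ?_
  rcases h with hz | rfl
  swap
  · rw [cell_univ_compl hM hL, complexity_accepts hM, Set.ncard_univ, Nat.card_eq_fintype_card,
      atomBound_self, ENat.card_eq_coe_fintype_card]
  rcases S.eq_empty_or_nonempty with rfl | hne
  · rw [Set.ncard_empty, atomBound_zero (by omega), Set.compl_empty]
    exact le_complexity_cell_empty_univ hT hS
  · have hlt := Set.ncard_lt_ncard (Set.ssubset_univ_iff.2 (ne_of_mem_of_not_mem' trivial hz).symm)
    rw [Set.ncard_univ, Nat.card_eq_fintype_card] at hlt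
    rw [atomBound_eq_ncard M.start ((Set.ncard_pos (Set.toFinite _)).2 hne).ne' hlt.ne]
    exact le_complexity_cell hT hS hne hz

end AtomLowerBound

section WordPerms

variable {α σ : Type*} {M : DFA α σ}

theorem wordMap_replicate (M : DFA α σ) (x : α) (k : ℕ) :
    wordMap M (List.replicate k x) = (wordMap M [x])^[k] := by
  induction k with
  | zero => rfl
  | succ k ih => rw [List.replicate_succ, wordMap_cons, ih, Function.iterate_succ]

theorem comp_mem_range_wordMap {f g : σ → σ} (hg : g ∈ Set.range (wordMap M))
    (hf : f ∈ Set.range (wordMap M)) : g ∘ f ∈ Set.range (wordMap M) := by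
  obtain ⟨u, rfl⟩ := hf
  obtain ⟨v, rfl⟩ := hg
  exact ⟨u ++ v, wordMap_append M u v⟩

/-- The submonoid of the permutations of the states of a DFA that are induced by words; it is a
subgroup when there are finitely many states, because the inverse of a permutation of finite order
is one of its powers. -/
def wordPerms [Finite σ] (M : DFA α σ) : Subgroup (Equiv.Perm σ) where
  carrier := {f | ⇑f ∈ Set.range (wordMap M)}
  mul_mem' := comp_mem_range_wordMap
  one_mem' := ⟨[], rfl⟩
  inv_mem' {f} hf := by
    have hpow (k : ℕ) : ⇑(f ^ k) ∈ Set.range (wordMap M) := by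
      induction k with
      | zero => exact ⟨[], rfl⟩
      | succ k ih => simpa only [pow_succ] using! comp_mem_range_wordMap ih hf
    have hinv : f⁻¹ = f ^ (orderOf f - 1) := inv_eq_of_mul_eq_one_left <| by
      rw [pow_sub_one_mul (orderOf_pos f).ne', pow_orderOf_eq_one]
    exact hinv ▸ hpow _

theorem preimage_mem_range_acceptingStates (x : α) {S : Set σ}
    (hS : S ∈ Set.range (acceptingStates M)) :
    wordMap M [x] ⁻¹' S ∈ Set.range (acceptingStates M) := by
  obtain ⟨w, rfl⟩ := hS
  exact ⟨x :: w, acceptingStates_append M [x] w⟩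

theorem image_mem_range_acceptingStates [Finite σ] {f : Equiv.Perm σ} (hf : f ∈ wordPerms M)
    {S : Set σ} (hS : S ∈ Set.range (acceptingStates M)) :
    f '' S ∈ Set.range (acceptingStates M) := by
  obtain ⟨w, hw⟩ := inv_mem hf
  obtain ⟨x, rfl⟩ := hS
  exact ⟨w ++ x, by rw [acceptingStates_append, hw, f.image_eq_preimage_symm]; rfl⟩

theorem isLeftIdeal_accepts_of_fixOrConst (hne : M.accepts ≠ 0) (hstart : M.start ∉ M.accept)
    (hM : ∀ w, wordMap M w ∈ fixOrConst M.start) : M.accepts.IsLeftIdeal := by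
  refine isLeftIdeal_iff.2 ⟨hne, fun u w hw => ?_⟩
  have hacc : wordMap M w M.start ∈ M.accept := hw
  change wordMap M (u ++ w) M.start ∈ M.accept
  rw [wordMap_append]
  rcases hM w with hfix | ⟨r, hr⟩
  · exact absurd (hfix ▸ hacc) hstart
  · rw [hr] at hacc ⊢
    exact hacc

theorem comp_mem_fixOrConst {Q : Type*} {z : Q} {f g : Q → Q} (hg : g ∈ fixOrConst z)
    (hf : f ∈ fixOrConst z) : g ∘ f ∈ fixOrConst z := by
  rcases hf with hf | ⟨r, rfl⟩
  · rcases hg with hg | ⟨s, rfl⟩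
    · exact Or.inl (by rw [Function.comp_apply, hf, hg])
    · exact Or.inr ⟨s, rfl⟩
  · exact Or.inr ⟨g r, rfl⟩

theorem wordMap_mem_fixOrConst {z : σ} (hM : ∀ x, wordMap M [x] ∈ fixOrConst z) (w : List α) :
    wordMap M w ∈ fixOrConst z := by
  induction w with
  | nil => exact Or.inl rfl
  | cons x w ih => exact wordMap_cons M x w ▸ comp_mem_fixOrConst ih (hM x)

theorem complexity_acceptsFrom (hM : M.IsMinimal) {q : σ} (hq : ∀ p, ∃ w, wordMap M w q = p) :
    (M.acceptsFrom q).complexity = ENat.card σ :=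
  complexity_accepts (M := { M with start := q }) ⟨hq, hM.2⟩

end WordPerms

section WitnessStep

variable {n : ℕ} (hn : 4 ≤ n)

theorem val_witnessStep_a (q : Fin n) : (witnessStep hn .a q).1 =
    if q.1 = 0 then 0 else if q.1 + 1 < n then q.1 + 1 else 1 := by
  simp only [witnessStep]
  split_ifs <;> simp_all

theorem witnessStep_a_injective : Function.Injective (witnessStep hn .a) := by
  intro p q h
  have hval := congrArg Fin.val h
  rw [val_witnessStep_a, val_witnessStep_a] at hval
  ext
  split_ifs at hval <;> omega

theorem witnessStep_a_bijective : Function.Bijective (witnessStep hn .a) :=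
  Finite.injective_iff_bijective.1 (witnessStep_a_injective hn)

theorem val_iterate_witnessStep_a {q : Fin n} (hq : 1 ≤ q.1) {k : ℕ} (hk : q.1 + k < n) :
    ((witnessStep hn .a)^[k] q).1 = q.1 + k := by
  induction k with
  | zero => rfl
  | succ k ih =>
    rw [Function.iterate_succ_apply', val_witnessStep_a, ih (by omega)]
    split_ifs <;> omega

theorem iterate_witnessStep_a_zero {q : Fin n} (hq : q.1 = 0) (k : ℕ) :
    (witnessStep hn .a)^[k] q = q :=
  Function.iterate_fixed (Fin.ext (by rw [val_witnessStep_a, if_pos hq, hq])) k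

theorem witnessStep_c_of_ne {q : Fin n} (hq : q.1 ≠ n - 1) : witnessStep hn .c q = q :=
  Function.update_of_ne (fun h => hq (congrArg Fin.val h)) _ _

theorem val_witnessStep_c_last {q : Fin n} (hq : q.1 = n - 1) : (witnessStep hn .c q).1 = 1 := by
  have hlast : q = ⟨n - 1, by omega⟩ := Fin.ext hq
  simp [witnessStep, hlast]

theorem witnessStep_d_of_ne {q : Fin n} (hq : q.1 ≠ n - 1) : witnessStep hn .d q = q :=
  Function.update_of_ne (fun h => hq (congrArg Fin.val h)) _ _

theorem val_witnessStep_d_last {q : Fin n} (hq : q.1 = n - 1) : (witnessStep hn .d q).1 = 0 := by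
  have hlast : q = ⟨n - 1, by omega⟩ := Fin.ext hq
  simp [witnessStep, hlast]

theorem val_witnessStep_e (q : Fin n) : (witnessStep hn .e q).1 = 1 := rfl

theorem witnessStep_mem_fixOrConst (x : Letter) :
    witnessStep hn x ∈ fixOrConst (⟨0, by omega⟩ : Fin n) := by
  cases x
  · exact Or.inl (Fin.ext (by simp [val_witnessStep_a]))
  · exact Or.inl (Equiv.swap_apply_of_ne_of_ne (by simp) (by simp))
  · exact Or.inl (witnessStep_c_of_ne hn (by simp only; omega))
  · exact Or.inl (witnessStep_d_of_ne hn (by simp only; omega))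
  · exact Or.inr ⟨_, rfl⟩

end WitnessStep

/-- The witness DFA with its letters renamed by `ρ`: the letter `x` acts as `ρ x`. Every dialect of
the witness language that the theorem mentions is accepted by such a DFA. -/
def witnessComap (n : ℕ) (hn : 4 ≤ n) {β : Type*} (ρ : β → Letter) : DFA β (Fin n) :=
  (witnessDFA n hn).comap ρ

section WitnessComap

variable {n : ℕ} {hn : 4 ≤ n} {β : Type*} {ρ : β → Letter} {a e : β} {p q : Fin n}

theorem wordMap_witnessComap_singleton (x : β) :
    wordMap (witnessComap n hn ρ) [x] = witnessStep hn (ρ x) := rfl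

theorem start_witnessComap : (witnessComap n hn ρ).start = ⟨0, by omega⟩ := rfl

theorem eq_start_witnessComap_iff : q = (witnessComap n hn ρ).start ↔ q.1 = 0 := Fin.ext_iff

theorem mem_acceptsFrom_witnessComap {w : List β} :
    w ∈ (witnessComap n hn ρ).acceptsFrom q ↔ (wordMap (witnessComap n hn ρ) w q).1 = n - 1 :=
  Fin.ext_iff

theorem wordMap_witnessComap_mem_fixOrConst (w : List β) :
    wordMap (witnessComap n hn ρ) w ∈ fixOrConst (witnessComap n hn ρ).start :=
  wordMap_mem_fixOrConst (fun x => witnessStep_mem_fixOrConst hn (ρ x)) w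

theorem wordMap_witnessComap_replicate_a (ha : ρ a = .a) (k : ℕ) :
    wordMap (witnessComap n hn ρ) (List.replicate k a) = (witnessStep hn .a)^[k] := by
  rw [wordMap_replicate, wordMap_witnessComap_singleton, ha]

theorem val_wordMap_witnessComap_e_a (ha : ρ a = .a) (he : ρ e = .e) (q : Fin n) {k : ℕ}
    (hk : 1 + k < n) :
    (wordMap (witnessComap n hn ρ) (e :: List.replicate k a) q).1 = 1 + k := by
  rw [wordMap_cons, wordMap_witnessComap_replicate_a ha, wordMap_witnessComap_singleton, he,
    Function.comp_apply, val_iterate_witnessStep_a hn (by rw [val_witnessStep_e])]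
  · rfl
  · rwa [val_witnessStep_e]

theorem exists_wordMap_witnessComap_eq (ha : ρ a = .a) (he : ρ e = .e) (q : Fin n)
    (hp : 1 ≤ p.1) : ∃ w, wordMap (witnessComap n hn ρ) w q = p := by
  refine ⟨e :: List.replicate (p.1 - 1) a, Fin.ext ?_⟩
  rw [val_wordMap_witnessComap_e_a ha he q (by omega)]
  omega

theorem e_a_mem_acceptsFrom_witnessComap (ha : ρ a = .a) (he : ρ e = .e) (q : Fin n) :
    e :: List.replicate (n - 2) a ∈ (witnessComap n hn ρ).acceptsFrom q := by
  rw [mem_acceptsFrom_witnessComap, val_wordMap_witnessComap_e_a ha he q (by omega)]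
  omega

theorem replicate_a_mem_acceptsFrom_witnessComap_iff (ha : ρ a = .a) (hp : 1 ≤ p.1) :
    List.replicate (n - 1 - p.1) a ∈ (witnessComap n hn ρ).acceptsFrom q ↔ q = p := by
  have hlast : ((witnessStep hn .a)^[n - 1 - p.1] p).1 = n - 1 := by
    rw [val_iterate_witnessStep_a hn hp (by omega)]
    omega
  rw [mem_acceptsFrom_witnessComap, wordMap_witnessComap_replicate_a ha,
    ← ((witnessStep_a_injective hn).iterate (n - 1 - p.1)).eq_iff, Fin.ext_iff, hlast]

theorem isMinimal_witnessComap (ha : ρ a = .a) (he : ρ e = .e) :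
    (witnessComap n hn ρ).IsMinimal := by
  refine ⟨fun p => ?_, fun p q h => ?_⟩
  · rcases Nat.eq_zero_or_pos p.1 with hp | hp
    · exact ⟨[], (eq_start_witnessComap_iff.2 hp).symm⟩
    · exact exists_wordMap_witnessComap_eq ha he _ hp
  · have heq {p q : Fin n} (hq : 1 ≤ q.1)
        (h : (witnessComap n hn ρ).acceptsFrom p = (witnessComap n hn ρ).acceptsFrom q) :
        p = q := by
      rw [← replicate_a_mem_acceptsFrom_witnessComap_iff (hn := hn) ha hq, h,
        replicate_a_mem_acceptsFrom_witnessComap_iff ha hq]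
    rcases Nat.eq_zero_or_pos q.1 with hq | hq
    · rcases Nat.eq_zero_or_pos p.1 with hp | hp
      · exact Fin.ext (hp.trans hq.symm)
      · exact (heq hp h.symm).symm
    · exact heq hq h

theorem isLeftIdeal_witnessComap (ha : ρ a = .a) (he : ρ e = .e) :
    (witnessComap n hn ρ).accepts.IsLeftIdeal := by
  refine isLeftIdeal_accepts_of_fixOrConst (fun hzero => ?_) (fun hstart => ?_)
    wordMap_witnessComap_mem_fixOrConst
  · have hmem : e :: List.replicate (n - 2) a ∈ (witnessComap n hn ρ).accepts :=
      e_a_mem_acceptsFrom_witnessComap ha he _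
    rwa [hzero] at hmem
  · have : 0 = n - 1 := congrArg Fin.val hstart
    omega

theorem complexity_quotient_witnessComap (hρ : {.a, .d, .e} ⊆ Set.range ρ) {q : Language β}
    (hq : q ∈ (witnessComap n hn ρ).accepts.quotients) : q.complexity = n := by
  simp only [Set.insert_subset_iff, Set.singleton_subset_iff] at hρ
  obtain ⟨⟨a, ha⟩, ⟨d, hd⟩, ⟨e, he⟩⟩ := hρ
  have hmin := isMinimal_witnessComap (hn := hn) ha he
  rw [quotients_accepts hmin] at hq
  obtain ⟨s, rfl⟩ := hq
  rw [complexity_acceptsFrom hmin, ENat.card_eq_coe_fintype_card, Fintype.card_fin]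
  intro p
  rcases Nat.eq_zero_or_pos p.1 with hp | hp
  · refine ⟨e :: List.replicate (n - 2) a ++ [d], Fin.ext ?_⟩
    rw [wordMap_append, wordMap_witnessComap_singleton, hd, hp]
    exact val_witnessStep_d_last hn
      (mem_acceptsFrom_witnessComap.1 (e_a_mem_acceptsFrom_witnessComap ha he s))
  · exact exists_wordMap_witnessComap_eq ha he _ hp

theorem accepts_witnessComap_mem_ofComplexity {β : Type} {ρ : β → Letter}
    (hρ : {.a, .e} ⊆ Set.range ρ) :
    (witnessComap n hn ρ).accepts ∈ ofComplexity RegularLeftIdeal n β := by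
  simp only [Set.insert_subset_iff, Set.singleton_subset_iff] at hρ
  obtain ⟨⟨a, ha⟩, ⟨e, he⟩⟩ := hρ
  refine ⟨⟨⟨Fin n, inferInstance, witnessComap n hn ρ, rfl⟩, isLeftIdeal_witnessComap ha he⟩, ?_⟩
  rw [complexity_accepts (isMinimal_witnessComap ha he), ENat.card_eq_coe_fintype_card,
    Fintype.card_fin]

end WitnessComap

section WitnessAtoms

variable {n : ℕ} {hn : 4 ≤ n} {β : Type*} {ρ : β → Letter} {a c d : β} {S : Set (Fin n)}

/-- The permutation `(2,…,n)` by which the letter `a` acts. -/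
noncomputable def cyclePerm {n : ℕ} (hn : 4 ≤ n) : Equiv.Perm (Fin n) :=
  Equiv.ofBijective _ (witnessStep_a_bijective hn)

theorem val_cyclePerm (q : Fin n) : (cyclePerm hn q).1 =
    if q.1 = 0 then 0 else if q.1 + 1 < n then q.1 + 1 else 1 :=
  val_witnessStep_a hn q

theorem cyclePerm_mem_wordPerms (ha : ρ a = .a) :
    cyclePerm hn ∈ wordPerms (witnessComap n hn ρ) :=
  ⟨[a], by rw [wordMap_witnessComap_singleton, ha]; rfl⟩

theorem cyclePerm_pow_apply (q : Fin n) (k : ℕ) :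
    (cyclePerm hn ^ k) q = (witnessStep hn .a)^[k] q := by
  rw [Equiv.Perm.coe_pow]
  rfl

theorem image_cyclePerm_last :
    cyclePerm hn '' {q | q.1 = n - 1} = {q : Fin n | 1 ≤ q.1 ∧ q.1 ≤ 1} := by
  rw [← Equiv.eq_preimage_iff_image_eq]
  ext q
  rw [Set.mem_preimage, Set.mem_ofPred_eq, Set.mem_ofPred_eq, val_cyclePerm]
  split_ifs <;> omega

theorem image_cyclePerm_preimage_c {k : ℕ} (hk : 1 ≤ k) (hkn : k + 1 < n) :
    cyclePerm hn '' (witnessStep hn .c ⁻¹' {q | 1 ≤ q.1 ∧ q.1 ≤ k}) =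
      {q | 1 ≤ q.1 ∧ q.1 ≤ k + 1} := by
  rw [← Equiv.eq_preimage_iff_image_eq]
  ext q
  rw [Set.mem_preimage, Set.mem_preimage, Set.mem_ofPred_eq, Set.mem_ofPred_eq, val_cyclePerm]
  by_cases hq : q.1 = n - 1
  · rw [val_witnessStep_c_last hn hq]
    split_ifs <;> omega
  · rw [witnessStep_c_of_ne hn hq]
    split_ifs <;> omega

theorem initial_segment_mem_range_acceptingStates (ha : ρ a = .a) (hc : ρ c = .c) {k : ℕ}
    (hk : 1 ≤ k) (hkn : k < n) :
    {q : Fin n | 1 ≤ q.1 ∧ q.1 ≤ k} ∈ Set.range (acceptingStates (witnessComap n hn ρ)) := by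
  induction k, hk using Nat.le_induction with
  | base =>
    have hnil : {q : Fin n | q.1 = n - 1} ∈ Set.range (acceptingStates (witnessComap n hn ρ)) :=
      ⟨[], Set.ext fun q => mem_acceptsFrom_witnessComap⟩
    exact image_cyclePerm_last (hn := hn) ▸
      image_mem_range_acceptingStates (cyclePerm_mem_wordPerms ha) hnil
  | succ k hk ih =>
    have hpre := preimage_mem_range_acceptingStates c (ih (by omega))
    rw [wordMap_witnessComap_singleton, hc] at hpre
    exact image_cyclePerm_preimage_c (hn := hn) hk hkn ▸
      image_mem_range_acceptingStates (cyclePerm_mem_wordPerms ha) hpre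

theorem preimage_d (hS : ∀ q ∈ S, q.1 ≠ 0) :
    witnessStep hn .d ⁻¹' S = S \ {⟨n - 1, by omega⟩} := by
  ext q
  rw [Set.mem_preimage, Set.mem_sdiff, Set.mem_singleton_iff, Fin.ext_iff]
  by_cases hq : q.1 = n - 1
  · exact iff_of_false (fun h => hS _ h (val_witnessStep_d_last hn hq)) fun h => h.2 hq
  · rw [witnessStep_d_of_ne hn hq, and_iff_left hq]

/- A power of `a` moves `p` to the last state, and then `d` removes it from the preimage. -/
theorem sdiff_singleton_mem_range_acceptingStates (ha : ρ a = .a) (hd : ρ d = .d)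
    (hstart : ∀ q ∈ S, q.1 ≠ 0) (hS : S ∈ Set.range (acceptingStates (witnessComap n hn ρ)))
    (p : Fin n) : S \ {p} ∈ Set.range (acceptingStates (witnessComap n hn ρ)) := by
  rcases Nat.eq_zero_or_pos p.1 with hp | hp
  · rwa [Set.sdiff_singleton_eq_self fun h => hstart p h hp]
  set f : Equiv.Perm (Fin n) := cyclePerm hn ^ (n - 1 - p.1)
  have hf : f ∈ wordPerms (witnessComap n hn ρ) := pow_mem (cyclePerm_mem_wordPerms ha) _
  have hfp : f p = ⟨n - 1, by omega⟩ := Fin.ext <| by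
    rw [cyclePerm_pow_apply, val_iterate_witnessStep_a hn hp (by omega)]
    simp only
    omega
  have hfstart (q : Fin n) (hq : q ∈ f '' S) : q.1 ≠ 0 := by
    obtain ⟨r, hr, rfl⟩ := hq
    intro hzero
    have hfix : f (f r) = f r :=
      (cyclePerm_pow_apply _ _).trans (iterate_witnessStep_a_zero hn hzero _)
    exact hstart r hr (f.injective hfix ▸ hzero)
  have hmem := preimage_mem_range_acceptingStates d (image_mem_range_acceptingStates hf hS)
  rw [wordMap_witnessComap_singleton, hd, preimage_d hfstart, ← hfp, ← Set.image_singleton,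
    ← Set.image_sdiff f.injective] at hmem
  have himage := image_mem_range_acceptingStates (inv_mem hf) hmem
  rwa [Equiv.Perm.coe_inv, Equiv.symm_image_image] at himage

theorem compl_start_sdiff_mem_range_acceptingStates (hρ : {.a, .c, .d} ⊆ Set.range ρ)
    (D : Set (Fin n)) :
    {(witnessComap n hn ρ).start}ᶜ \ D ∈ Set.range (acceptingStates (witnessComap n hn ρ)) := by
  simp only [Set.insert_subset_iff, Set.singleton_subset_iff] at hρ
  obtain ⟨⟨a, ha⟩, ⟨c, hc⟩, ⟨d, hd⟩⟩ := hρ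
  induction D, D.toFinite using Set.Finite.induction_on with
  | empty =>
    convert initial_segment_mem_range_acceptingStates (hn := hn) ha hc
      (show 1 ≤ n - 1 by omega) (by omega) using 1
    ext q
    rw [Set.sdiff_empty, Set.mem_compl_singleton_iff, Ne, eq_start_witnessComap_iff,
      Set.mem_ofPred_eq]
    omega
  | @insert p D _ _ ih =>
    rw [Set.insert_eq, Set.union_comm, ← Set.sdiff_sdiff]
    exact sdiff_singleton_mem_range_acceptingStates ha hd
      (fun q hq hzero => hq.1 (eq_start_witnessComap_iff.2 hzero)) ih p

theorem mem_range_acceptingStates (hρ : {.a, .c, .d} ⊆ Set.range ρ)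
    (hS : (witnessComap n hn ρ).start ∉ S) :
    S ∈ Set.range (acceptingStates (witnessComap n hn ρ)) := by
  have hmem := compl_start_sdiff_mem_range_acceptingStates (hn := hn) hρ Sᶜ
  rwa [sdiff_compl, inf_of_le_right (Set.subset_compl_singleton_iff.2 hS)] at hmem

theorem encard_atoms_witnessComap (hρ : {.a, .c, .d, .e} ⊆ Set.range ρ) :
    (witnessComap n hn ρ).accepts.atoms.encard = (2 ^ (n - 1) + 1 : ℕ) := by
  have hacd : {.a, .c, .d} ⊆ Set.range ρ := fun x hx => hρ (by simp_all; tauto)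
  obtain ⟨a, ha⟩ : .a ∈ Set.range ρ := hρ (by simp)
  obtain ⟨e, he⟩ : .e ∈ Set.range ρ := hρ (by simp)
  have hmin := isMinimal_witnessComap (hn := hn) ha he
  have hcard := ncard_setOf_notMem_or_univ (witnessComap n hn ρ).start
  rw [Fintype.card_fin] at hcard
  rw [encard_atoms_accepts hmin, ← hcard, (Set.toFinite _).cast_ncard_eq]
  congr 1
  ext S
  constructor
  · rintro ⟨x, rfl⟩
    exact start_notMem_or_eq_univ hmin (isLeftIdeal_witnessComap ha he) x
  · rintro (hS | rfl)
    · exact mem_range_acceptingStates hacd hS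
    · exact ⟨_, Set.eq_univ_of_forall (e_a_mem_acceptsFrom_witnessComap ha he)⟩

end WitnessAtoms

section FullTransformations

variable {α σ : Type*} [Finite σ] {M : DFA α σ} {z p q : σ}

theorem perm_mem_of_swap_mem {Q : Type*} [Finite Q] [DecidableEq Q] {G : Subgroup (Equiv.Perm Q)}
    {z : Q} (hG : ∀ p q, p ≠ z → q ≠ z → Equiv.swap p q ∈ G) {f : Equiv.Perm Q} (hf : f z = z) :
    f ∈ G := by
  let swaps : Set (Equiv.Perm Q) := {s | s.IsSwap ∧ s ∈ G}
  have hswaps : Subgroup.closure swaps ≤ G := (Subgroup.closure_le G).2 fun s hs => hs.2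
  refine hswaps ((mem_closure_isSwap fun s hs => hs.1).2 ⟨Set.toFinite _, fun x => ?_⟩)
  by_cases hx : f x = x
  · exact hx.symm ▸ MulAction.mem_orbit_self x
  · have hxz : x ≠ z := fun h => hx (h ▸ hf)
    have hfxz : f x ≠ z := fun h => hxz (f.injective (h.trans hf.symm))
    have hmem : Equiv.swap x (f x) ∈ Subgroup.closure swaps :=
      Subgroup.subset_closure ⟨⟨x, f x, Ne.symm hx, rfl⟩, hG _ _ hxz hfxz⟩
    exact ⟨⟨_, hmem⟩, Equiv.swap_apply_left _ _⟩

theorem update_perm_mem_range_wordMap [DecidableEq σ] {f : Equiv.Perm σ} (hf : f ∈ wordPerms M)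
    (h : Function.update id p q ∈ Set.range (wordMap M)) :
    Function.update id (f p) (f q) ∈ Set.range (wordMap M) := by
  have hconj : Function.update id (f p) (f q) = f ∘ Function.update id p q ∘ ⇑f⁻¹ := by
    funext r
    obtain ⟨r, rfl⟩ := f.surjective r
    rcases eq_or_ne r p with rfl | hr
    · simp
    · simp [Function.update_of_ne (f.injective.ne hr), Function.update_of_ne hr]
  rw [hconj]
  exact comp_mem_range_wordMap hf (comp_mem_range_wordMap h (inv_mem hf))

/- Composing with permutations that fix `z` moves `p, q` to any other pair `r, s`. -/
theorem update_mem_range_wordMap [DecidableEq σ]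
    (hperm : ∀ f : Equiv.Perm σ, f z = z → f ∈ wordPerms M)
    (hpz : p ≠ z) (hqz : q ≠ z) (hpq : p ≠ q)
    (hq : Function.update id p q ∈ Set.range (wordMap M))
    (hz : Function.update id p z ∈ Set.range (wordMap M)) {r s : σ} (hr : r ≠ z) (hrs : r ≠ s) :
    Function.update id r s ∈ Set.range (wordMap M) := by
  have hfrom (s : σ) (hs : p ≠ s) : Function.update id p s ∈ Set.range (wordMap M) := by
    rcases eq_or_ne s z with rfl | hsz
    · exact hz
    · have hmem := update_perm_mem_range_wordMap
        (hperm (Equiv.swap q s) (Equiv.swap_apply_of_ne_of_ne hqz.symm hsz.symm)) hq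
      rwa [Equiv.swap_apply_of_ne_of_ne hpq hs, Equiv.swap_apply_left] at hmem
  have hne : p ≠ Equiv.swap p r s := by
    rw [← (Equiv.swap p r).injective.ne_iff, Equiv.swap_apply_left, Equiv.swap_apply_self]
    exact hrs
  have hmem := update_perm_mem_range_wordMap
    (hperm (Equiv.swap p r) (Equiv.swap_apply_of_ne_of_ne hpz.symm hr.symm)) (hfrom _ hne)
  rwa [Equiv.swap_apply_left, Equiv.swap_apply_self] at hmem

theorem update_comp_update {Q : Type*} [DecidableEq Q] {p q : Q} {t : Q → Q} (hpq : p ≠ q)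
    (ht : t p = t q) (r : Q) :
    Function.update t p r ∘ Function.update id p q = t := by
  funext x
  rcases eq_or_ne x p with rfl | hx
  · simp [Function.update_of_ne hpq.symm, ht]
  · simp [Function.update_of_ne hx]

theorem ncard_compl_range_update_lt [DecidableEq σ] {t : σ → σ} (hpq : p ≠ q) (ht : t p = t q)
    {r : σ} (hr : r ∉ Set.range t) :
    (Set.range (Function.update t p r))ᶜ.ncard < (Set.range t)ᶜ.ncard := by
  refine Set.ncard_lt_ncard (compl_lt_compl_iff_lt.2 ⟨?_, fun h => ?_⟩) (Set.toFinite _)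
  · rintro _ ⟨x, rfl⟩
    rcases eq_or_ne x p with rfl | hx
    · exact ⟨q, by rw [Function.update_of_ne hpq.symm, ht]⟩
    · exact ⟨x, Function.update_of_ne hx _ _⟩
  · exact hr (h ⟨p, Function.update_self _ _ _⟩)

/- A non-injective `t` factors through a transformation with a larger range and one that merges two
states. -/
theorem mem_range_wordMap_of_fixes [DecidableEq σ]
    (hperm : ∀ f : Equiv.Perm σ, f z = z → f ∈ wordPerms M)
    (hupdate : ∀ p q, p ≠ z → p ≠ q → Function.update id p q ∈ Set.range (wordMap M))
    {t : σ → σ} (ht : t z = z) : t ∈ Set.range (wordMap M) := by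
  induction hk : (Set.range t)ᶜ.ncard using Nat.strong_induction_on generalizing t with
  | _ k ih =>
    by_cases hinj : Function.Injective t
    · exact hperm (Equiv.ofBijective t (Finite.injective_iff_bijective.1 hinj)) ht
    obtain ⟨p, q, hpz, hpq, heq⟩ : ∃ p q, p ≠ z ∧ p ≠ q ∧ t p = t q := by
      simp only [Function.Injective, not_forall] at hinj
      obtain ⟨p, q, heq, hpq⟩ := hinj
      rcases eq_or_ne p z with rfl | hpz
      · exact ⟨q, p, Ne.symm hpq, Ne.symm hpq, heq.symm⟩
      · exact ⟨p, q, hpz, hpq, heq⟩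
    obtain ⟨r, hr⟩ : ∃ r, r ∉ Set.range t := by
      by_contra! hsurj
      exact hinj (Finite.injective_iff_surjective.2 hsurj)
    rw [← update_comp_update hpq heq r]
    refine comp_mem_range_wordMap (ih _ ?_ ?_ rfl) (hupdate p q hpz hpq)
    · exact hk ▸ ncard_compl_range_update_lt hpq heq hr
    · rwa [Function.update_of_ne hpz.symm]

end FullTransformations

section WitnessSemigroup

variable {n : ℕ} {hn : 4 ≤ n} {β : Type*} {ρ : β → Letter} {a b c d e : β}

/- Conjugating the transposition `b = (2,3)` by powers of the cycle `a` gives all transpositions of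
adjacent states other than `1`. -/
theorem swap_succ_mem_wordPerms (ha : ρ a = .a) (hb : ρ b = .b) {i : ℕ} (hi : 1 ≤ i)
    (hin : i + 1 < n) :
    Equiv.swap ⟨i, by omega⟩ ⟨i + 1, hin⟩ ∈ wordPerms (witnessComap n hn ρ) := by
  induction i, hi using Nat.le_induction with
  | base => exact ⟨[b], by rw [wordMap_witnessComap_singleton, hb]; rfl⟩
  | succ i hi ih =>
    have hcycle := cyclePerm_mem_wordPerms (hn := hn) ha
    have hconj := mul_mem (mul_mem hcycle (ih (by omega))) (inv_mem hcycle)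
    rw [← Equiv.swap_apply_apply] at hconj
    convert hconj using 2
    · ext; rw [val_cyclePerm]; simp only; split_ifs <;> omega
    · ext; rw [val_cyclePerm]; simp only; split_ifs <;> omega

theorem swap_mem_wordPerms (ha : ρ a = .a) (hb : ρ b = .b) {p q : Fin n} (hp : 1 ≤ p.1)
    (hq : 1 ≤ q.1) : Equiv.swap p q ∈ wordPerms (witnessComap n hn ρ) := by
  have hone (i : ℕ) (hi : 1 ≤ i) (hin : i < n) :
      Equiv.swap ⟨1, by omega⟩ ⟨i, hin⟩ ∈ wordPerms (witnessComap n hn ρ) := by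
    induction i, hi using Nat.le_induction with
    | base => exact Equiv.swap_self (⟨1, hin⟩ : Fin n) ▸ one_mem _
    | succ i hi ih =>
      exact SubmonoidClass.swap_mem_trans _ (ih (by omega)) (swap_succ_mem_wordPerms ha hb hi hin)
  exact SubmonoidClass.swap_mem_trans _ (Equiv.swap_comm _ p ▸ hone p.1 hp p.2) (hone q.1 hq q.2)

theorem perm_mem_wordPerms (ha : ρ a = .a) (hb : ρ b = .b) {f : Equiv.Perm (Fin n)}
    (hf : f (witnessComap n hn ρ).start = (witnessComap n hn ρ).start) :
    f ∈ wordPerms (witnessComap n hn ρ) := by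
  have hpos {p : Fin n} (hp : p ≠ (witnessComap n hn ρ).start) : 1 ≤ p.1 :=
    Nat.pos_of_ne_zero fun h => hp (eq_start_witnessComap_iff.2 h)
  exact perm_mem_of_swap_mem
    (fun p q hp hq => swap_mem_wordPerms ha hb (hpos hp) (hpos hq)) hf

theorem mem_range_wordMap_witnessComap (ha : ρ a = .a) (hb : ρ b = .b) (hc : ρ c = .c)
    (hd : ρ d = .d) {t : Fin n → Fin n}
    (ht : t (witnessComap n hn ρ).start = (witnessComap n hn ρ).start) :
    t ∈ Set.range (wordMap (witnessComap n hn ρ)) := by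
  have hperm (f : Equiv.Perm (Fin n)) := perm_mem_wordPerms (hn := hn) (f := f) ha hb
  refine mem_range_wordMap_of_fixes hperm (fun p q hp hpq => ?_) ht
  refine update_mem_range_wordMap hperm (p := ⟨n - 1, by omega⟩) (q := ⟨1, by omega⟩) ?_ ?_ ?_
    ⟨[c], ?_⟩ ⟨[d], ?_⟩ hp hpq
  · rw [Ne, eq_start_witnessComap_iff]
    simp only
    omega
  · rw [Ne, eq_start_witnessComap_iff]
    exact one_ne_zero
  · rw [Ne, Fin.ext_iff]
    simp only
    omega
  · rw [wordMap_witnessComap_singleton, hc]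
    rfl
  · rw [wordMap_witnessComap_singleton, hd]
    rfl

theorem transitions_witnessComap (hρ : Function.Surjective ρ) :
    transitions (witnessComap n hn ρ) = fixOrConst (witnessComap n hn ρ).start := by
  obtain ⟨a, ha⟩ := hρ .a
  obtain ⟨b, hb⟩ := hρ .b
  obtain ⟨c, hc⟩ := hρ .c
  obtain ⟨d, hd⟩ := hρ .d
  obtain ⟨e, he⟩ := hρ .e
  refine subset_antisymm ?_ fun t ht => ?_
  · rintro _ ⟨w, -, rfl⟩
    exact wordMap_witnessComap_mem_fixOrConst w
  by_cases hfix : t (witnessComap n hn ρ).start = (witnessComap n hn ρ).start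
  · -- A word of length two that acts as the identity provides a non-empty word for the identity.
    obtain ⟨w, rfl⟩ := mem_range_wordMap_witnessComap ha hb hc hd hfix
    refine ⟨[b] ++ [b] ++ w, by simp, ?_⟩
    rw [wordMap_append, wordMap_append, wordMap_witnessComap_singleton, hb]
    funext q
    exact congrArg _ (Equiv.swap_apply_self _ _ q)
  · obtain ⟨r, rfl⟩ := ht.resolve_left hfix
    have hr : 1 ≤ r.1 := Nat.pos_of_ne_zero fun h => hfix (eq_start_witnessComap_iff.2 h)
    refine ⟨e :: List.replicate (r.1 - 1) a, List.cons_ne_nil _ _, funext fun q => Fin.ext ?_⟩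
    rw [val_wordMap_witnessComap_e_a ha he q (by omega), Function.const_apply]
    omega

theorem syntacticSize_witnessComap (hρ : Function.Surjective ρ) :
    (witnessComap n hn ρ).accepts.syntacticSize = (n ^ (n - 1) + n - 1 : ℕ) := by
  obtain ⟨a, ha⟩ := hρ .a
  obtain ⟨e, he⟩ := hρ .e
  have hcard := ncard_fixOrConst (witnessComap n hn ρ).start
  rw [Fintype.card_fin] at hcard
  rw [syntacticSize_accepts (isMinimal_witnessComap ha he), transitions_witnessComap hρ, ← hcard,
    (Set.toFinite _).cast_ncard_eq]

theorem complexity_atom_witnessComap (hρ : Function.Surjective ρ) {A : Language β}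
    (hA : A ∈ (witnessComap n hn ρ).accepts.atoms) :
    A.complexity = atomBound n ((witnessComap n hn ρ).accepts.atomIndex A).ncard := by
  obtain ⟨a, ha⟩ := hρ .a
  obtain ⟨e, he⟩ := hρ .e
  have hmin := isMinimal_witnessComap (hn := hn) ha he
  have hideal := isLeftIdeal_witnessComap (hn := hn) ha he
  rw [atoms_eq_range_atomOf] at hA
  obtain ⟨x, rfl⟩ := hA
  rw [ncard_atomIndex_atomOf hmin, atomOf_accepts hmin, complexity_cell_eq hmin hideal
    (by rw [Fintype.card_fin]; omega) (transitions_witnessComap hρ).ge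
    (fun S hS => mem_range_acceptingStates (fun x _ => hρ x) hS)
    (start_notMem_or_eq_univ hmin hideal x), Fintype.card_fin]

end WitnessSemigroup

section StarProduct

variable {m n : ℕ} {hm : 4 ≤ m} {hn : 4 ≤ n} {β : Type*} {ρ : β → Letter} {a e : β}

theorem le_add_of_replicate_a_mem_acceptsFrom (ha : ρ a = .a) {q : Fin n} {k : ℕ}
    (h : List.replicate k a ∈ (witnessComap n hn ρ).acceptsFrom q) :
    1 ≤ q.1 ∧ n - 1 ≤ q.1 + k := by
  rw [mem_acceptsFrom_witnessComap, wordMap_witnessComap_replicate_a ha] at h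
  have hq : 1 ≤ q.1 := by
    by_contra hq
    rw [iterate_witnessStep_a_zero hn (by omega)] at h
    omega
  refine ⟨hq, ?_⟩
  by_contra hlt
  rw [val_iterate_witnessStep_a hn hq (by omega)] at h
  omega

theorem replicate_a_notMem_accepts (ha : ρ a = .a) (k : ℕ) :
    List.replicate k a ∉ (witnessComap n hn ρ).accepts := fun h =>
  absurd (le_add_of_replicate_a_mem_acceptsFrom ha h).1 (by simp [start_witnessComap])

theorem cons_replicate_mem_accepts_iff (ha : ρ a = .a) (he : ρ e = .e) {j : ℕ} (hj : 1 + j < n) :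
    e :: List.replicate j a ∈ (witnessComap n hn ρ).accepts ↔ j = n - 2 := by
  change _ ∈ (witnessComap n hn ρ).acceptsFrom _ ↔ _
  rw [mem_acceptsFrom_witnessComap, val_wordMap_witnessComap_e_a ha he _ hj]
  omega

theorem kstar_notMem_quotients_witnessComap (ha : ρ a = .a) (he : ρ e = .e) :
    (witnessComap n hn ρ).accepts∗ ∉ (witnessComap n hn ρ).accepts.quotients := by
  rw [quotients_accepts (isMinimal_witnessComap ha he)]
  rintro ⟨q, hq⟩
  have hlast : q.1 = n - 1 := mem_acceptsFrom_witnessComap.1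
    (hq ▸ nil_mem_kstar _ : [] ∈ (witnessComap n hn ρ).acceptsFrom q)
  have hcycle : List.replicate (n - 1) a ∈ (witnessComap n hn ρ).acceptsFrom q := by
    have hstep : (witnessStep hn .a q).1 = 1 := by
      rw [val_witnessStep_a]
      split_ifs <;> omega
    rw [mem_acceptsFrom_witnessComap, wordMap_witnessComap_replicate_a ha,
      show n - 1 = (n - 2) + 1 by omega, Function.iterate_succ_apply,
      val_iterate_witnessStep_a hn hstep.ge (by omega), hstep]
    omega
  rw [hq, mem_kstar_iff (isLeftIdeal_witnessComap ha he)] at hcycle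
  rcases hcycle with hnil | hmem
  · rw [List.replicate_eq_nil_iff] at hnil
    omega
  · exact replicate_a_notMem_accepts ha _ hmem

theorem quotients_kstar {L : Language β} (hL : L.IsLeftIdeal) {w : List β} (hne : w ≠ [])
    (hw : L.leftQuotient w = L) : L∗.quotients = insert L∗ L.quotients := by
  refine subset_antisymm ?_ (Set.insert_subset (self_mem_quotients _) ?_)
  · rintro _ ⟨u, rfl⟩
    rcases eq_or_ne u [] with rfl | hu
    · exact Set.mem_insert _ _
    · exact Or.inr (leftQuotient_kstar hL hu ▸ leftQuotient_mem_quotients L u)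
  · rintro _ ⟨u, rfl⟩
    rcases eq_or_ne u [] with rfl | hu
    · exact ⟨w, by rw [leftQuotient_kstar hL hne, hw, leftQuotient_nil]⟩
    · exact ⟨u, leftQuotient_kstar hL hu⟩

theorem complexity_kstar_witnessComap (hρ : {.a, .e} ⊆ Set.range ρ) :
    (witnessComap n hn ρ).accepts∗.complexity = (n + 1 : ℕ) := by
  simp only [Set.insert_subset_iff, Set.singleton_subset_iff] at hρ
  obtain ⟨⟨a, ha⟩, ⟨e, he⟩⟩ := hρ
  have hfix : (witnessComap n hn ρ).accepts.leftQuotient [a] = (witnessComap n hn ρ).accepts := by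
    rw [leftQuotient_accepts_apply]
    change (witnessComap n hn ρ).acceptsFrom (witnessStep hn (ρ a) _) = _
    rw [ha]
    exact congrArg _ (iterate_witnessStep_a_zero hn (q := (witnessComap n hn ρ).start) rfl 1)
  rw [complexity, quotients_kstar (isLeftIdeal_witnessComap ha he) (List.cons_ne_nil a []) hfix,
    Set.encard_insert_of_notMem (kstar_notMem_quotients_witnessComap ha he), ← complexity,
    complexity_accepts (isMinimal_witnessComap ha he), ENat.card_eq_coe_fintype_card,
    Fintype.card_fin, Nat.cast_add, Nat.cast_one]

theorem cons_replicate_minimal (ha : ρ a = .a) (he : ρ e = .e) {j : ℕ} (hj : 1 + j < n)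
    {s : List β} (hs : s <+: e :: List.replicate j a) (hmem : s ∈ (witnessComap n hn ρ).accepts) :
    s = e :: List.replicate (n - 2) a := by
  rcases List.prefix_cons_iff.1 hs with rfl | ⟨t, rfl, u, hu⟩
  · exact absurd hmem (replicate_a_notMem_accepts ha 0)
  · obtain ⟨hlen, ht, -⟩ := List.append_eq_replicate_iff.1 hu
    rw [ht, cons_replicate_mem_accepts_iff ha he (by omega)] at hmem
    rw [ht, hmem]

theorem acceptsFrom_mul_mem_quotients_mul (ha : ρ a = .a) (he : ρ e = .e) {p : Fin m}
    (hp : p.1 ≠ m - 1) (K : Language β) :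
    (witnessComap m hm ρ).acceptsFrom p * K ∈
      ((witnessComap m hm ρ).accepts * K).quotients := by
  rcases Nat.eq_zero_or_pos p.1 with hzero | hpos
  · rw [eq_start_witnessComap_iff.2 hzero]
    exact self_mem_quotients _
  · refine ⟨e :: List.replicate (p.1 - 1) a, ?_⟩
    rw [leftQuotient_mul_of_forall_prefix_notMem, leftQuotient_accepts_apply]
    · congr 2
      ext
      refine (val_wordMap_witnessComap_e_a ha he _ (by omega)).trans ?_
      omega
    · intro s hs hmem
      have hlen := hs.length_le
      rw [cons_replicate_minimal ha he (by omega) hs hmem] at hlen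
      simp only [List.length_cons, List.length_replicate] at hlen
      omega

theorem quotients_subset_quotients_mul (ha : ρ a = .a) (he : ρ e = .e) {K : Language β}
    (hK : K.IsLeftIdeal) : K.quotients ⊆ ((witnessComap m hm ρ).accepts * K).quotients := by
  rintro _ ⟨v, rfl⟩
  exact ⟨e :: List.replicate (m - 2) a ++ v, leftQuotient_mul_append hK
    ((cons_replicate_mem_accepts_iff ha he (by omega)).2 rfl)
    fun s hs hmem => cons_replicate_minimal ha he (by omega) hs hmem⟩

theorem replicate_a_notMem_mul (ha : ρ a = .a) (L : Language β) (k : ℕ) :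
    List.replicate k a ∉ L * (witnessComap n hn ρ).accepts := by
  rw [mem_mul]
  rintro ⟨u, -, v, hv, h⟩
  rw [(List.append_eq_replicate_iff.1 h).2.2] at hv
  exact replicate_a_notMem_accepts ha _ hv

theorem exists_replicate_a_mem_of_mem_mul (ha : ρ a = .a) {L : Language β} {k l : ℕ}
    (h : List.replicate k a ++ e :: List.replicate l a ∈ L * (witnessComap n hn ρ).accepts) :
    ∃ i ≤ k, List.replicate i a ∈ L := by
  obtain ⟨u, hu, v, hv, huv⟩ := mem_mul.1 h
  rcases List.append_eq_append_iff.1 huv with ⟨s, hs, -⟩ | ⟨s, rfl, hs⟩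
  · obtain ⟨hlen, hrep, -⟩ := List.append_eq_replicate_iff.1 hs.symm
    exact ⟨u.length, by omega, hrep ▸ hu⟩
  · rcases s with _ | ⟨x, s⟩
    · exact ⟨k, le_rfl, by simpa only [List.append_nil] using hu⟩
    · rw [List.cons_append, List.cons.injEq] at hs
      rw [(List.append_eq_replicate_iff.1 hs.2.symm).2.2] at hv
      exact absurd hv (replicate_a_notMem_accepts ha _)

theorem replicate_a_append_mem_mul_iff (ha : ρ a = .a) (he : ρ e = .e) {p : Fin m} {k : ℕ} :
    List.replicate k a ++ e :: List.replicate (n - 2) a ∈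
        (witnessComap m hm ρ).acceptsFrom p * (witnessComap n hn ρ).accepts ↔
      1 ≤ p.1 ∧ m - 1 ≤ p.1 + k := by
  constructor
  · intro h
    obtain ⟨i, hi, hmem⟩ := exists_replicate_a_mem_of_mem_mul ha h
    obtain ⟨hp, hle⟩ := le_add_of_replicate_a_mem_acceptsFrom ha hmem
    exact ⟨hp, by omega⟩
  · rintro ⟨hp, hle⟩
    refine mem_mul.2 ⟨_, (replicate_a_mem_acceptsFrom_witnessComap_iff ha hp).2 rfl, _,
      append_mem (isLeftIdeal_witnessComap ha he) (List.replicate (k - (m - 1 - p.1)) a)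
        ((cons_replicate_mem_accepts_iff ha he (by omega)).2 rfl), ?_⟩
    rw [← List.append_assoc, List.replicate_append_replicate]
    congr 2
    omega

theorem acceptsFrom_mul_injective (ha : ρ a = .a) (he : ρ e = .e) :
    Function.Injective fun p : Fin m =>
      (witnessComap m hm ρ).acceptsFrom p * (witnessComap n hn ρ).accepts := by
  intro p q h
  have hiff (k : ℕ) : 1 ≤ p.1 ∧ m - 1 ≤ p.1 + k ↔ 1 ≤ q.1 ∧ m - 1 ≤ q.1 + k := by
    rw [← replicate_a_append_mem_mul_iff (n := n) (hn := hn) ha he,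
      ← replicate_a_append_mem_mul_iff (n := n) (hn := hn) ha he]
    exact Set.ext_iff.1 h _
  have hp := hiff (m - 1 - p.1)
  have hq := hiff (m - 1 - q.1)
  omega

theorem acceptsFrom_mul_notMem_quotients (ha : ρ a = .a) (he : ρ e = .e) {p : Fin m}
    (hp : p.1 ≠ m - 1) :
    (witnessComap m hm ρ).acceptsFrom p * (witnessComap n hn ρ).accepts ∉
      (witnessComap n hn ρ).accepts.quotients := by
  rw [quotients_accepts (isMinimal_witnessComap ha he)]
  rintro ⟨q, hq⟩
  rcases Nat.eq_zero_or_pos q.1 with hzero | hpos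
  · obtain rfl : q = (witnessComap n hn ρ).start := eq_start_witnessComap_iff.2 hzero
    have hmem : List.replicate 0 a ++ e :: List.replicate (n - 2) a ∈
        (witnessComap m hm ρ).acceptsFrom p * (witnessComap n hn ρ).accepts :=
      hq ▸ e_a_mem_acceptsFrom_witnessComap ha he _
    rw [replicate_a_append_mem_mul_iff ha he] at hmem
    omega
  · exact replicate_a_notMem_mul ha _ _
      (hq ▸ (replicate_a_mem_acceptsFrom_witnessComap_iff (hn := hn) ha hpos).2 rfl)

theorem complexity_mul_witnessComap {β : Type} {ρ : β → Letter} (hρ : {.a, .e} ⊆ Set.range ρ) :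
    ((witnessComap m hm ρ).accepts * (witnessComap n hn ρ).accepts).complexity =
      (m + n - 1 : ℕ) := by
  refine le_antisymm (complexity_mul_le (accepts_witnessComap_mem_ofComplexity hρ)
    (accepts_witnessComap_mem_ofComplexity hρ)) ?_
  have hn' := (accepts_witnessComap_mem_ofComplexity (n := n) (hn := hn) hρ).2
  simp only [Set.insert_subset_iff, Set.singleton_subset_iff] at hρ
  obtain ⟨⟨a, ha⟩, ⟨e, he⟩⟩ := hρ
  set K := (witnessComap n hn ρ).accepts
  set S : Set (Language β) := (fun p : Fin m => (witnessComap m hm ρ).acceptsFrom p * K) ''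
    {⟨m - 1, by omega⟩}ᶜ
  have hScard : S.encard = (m - 1 : ℕ) := by
    rw [(acceptsFrom_mul_injective ha he).encard_image, ← (Set.toFinite _).cast_ncard_eq,
      Set.ncard_compl, Set.ncard_singleton, Nat.card_fin]
  have hdisj : Disjoint S K.quotients := by
    rw [Set.disjoint_left]
    rintro _ ⟨p, hp, rfl⟩
    exact acceptsFrom_mul_notMem_quotients ha he fun h => hp (Fin.ext h)
  have hsub : S ∪ K.quotients ⊆ ((witnessComap m hm ρ).accepts * K).quotients := by
    refine Set.union_subset ?_
      (quotients_subset_quotients_mul ha he (isLeftIdeal_witnessComap ha he))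
    rintro _ ⟨p, hp, rfl⟩
    exact acceptsFrom_mul_mem_quotients_mul ha he (fun h => hp (Fin.ext h)) K
  calc ((m + n - 1 : ℕ) : ℕ∞) = (m - 1 : ℕ) + n := by rw [← Nat.cast_add]; congr 1; omega
    _ = (S ∪ K.quotients).encard := by
      rw [Set.encard_union_eq hdisj, hScard, ← complexity, hn']
    _ ≤ ((witnessComap m hm ρ).accepts * K).complexity := Set.encard_le_encard hsub

end StarProduct

section BoolOp

variable {α σ σ' : Type*} {M : DFA α σ} {M' : DFA α σ'} {f : Bool → Bool → Bool}

theorem isProper_flip (hf : IsProper f) : IsProper (flip f) :=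
  ⟨fun ⟨g, hg⟩ => hf.2 ⟨g, fun x y => hg y x⟩, fun ⟨g, hg⟩ => hf.1 ⟨g, fun x y => hg y x⟩⟩

theorem exists_ne_of_isProper (hf : IsProper f) : ∃ y, f true y ≠ f false y := by
  by_contra! h
  exact hf.2 ⟨f true, fun x y => by cases x; exacts [(h y).symm, rfl]⟩

theorem boolOp_ne_boolOp (hf : IsProper f) {K K' L L' : Language α}
    (h : ∀ T : Prop, ∃ w, ¬(w ∈ K ↔ w ∈ K') ∧ (w ∈ L ↔ T) ∧ (w ∈ L' ↔ T)) :
    boolOp f K L ≠ boolOp f K' L' := by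
  classical
  intro heq
  obtain ⟨y, hy⟩ := exists_ne_of_isProper hf
  obtain ⟨w, hK, hL, hL'⟩ := h (y = true)
  have hiff : f (decide (w ∈ K)) (decide (w ∈ L)) = true ↔
      f (decide (w ∈ K')) (decide (w ∈ L')) = true := Set.ext_iff.1 heq w
  rw [← Bool.eq_iff_iff, (by simp [hL] : decide (w ∈ L) = y),
    (by simp [hL'] : decide (w ∈ L') = y)] at hiff
  by_cases hwK : w ∈ K <;> by_cases hwK' : w ∈ K' <;> simp_all

theorem quotients_boolOp_accepts (hreach : ∀ p q, ∃ w, M.eval w = p ∧ M'.eval w = q) :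
    (boolOp f M.accepts M'.accepts).quotients =
      Set.range fun x : σ × σ' => boolOp f (M.acceptsFrom x.1) (M'.acceptsFrom x.2) := by
  have hquot (w : List α) : (boolOp f M.accepts M'.accepts).leftQuotient w =
      boolOp f (M.acceptsFrom (M.eval w)) (M'.acceptsFrom (M'.eval w)) := by
    rw [leftQuotient_boolOp, leftQuotient_accepts_apply, leftQuotient_accepts_apply]
  refine subset_antisymm ?_ ?_
  · rintro _ ⟨w, rfl⟩
    exact ⟨(M.eval w, M'.eval w), (hquot w).symm⟩
  · rintro _ ⟨⟨p, q⟩, rfl⟩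
    obtain ⟨w, rfl, rfl⟩ := hreach p q
    exact ⟨w, hquot w⟩

theorem complexity_boolOp_accepts (hf : IsProper f)
    (hreach : ∀ p q, ∃ w, M.eval w = p ∧ M'.eval w = q)
    (hsep : ∀ p p', p ≠ p' → ∀ T : Prop,
      ∃ w, ¬(w ∈ M.acceptsFrom p ↔ w ∈ M.acceptsFrom p') ∧ ∀ q, w ∈ M'.acceptsFrom q ↔ T)
    (hsep' : ∀ q q', q ≠ q' → ∀ T : Prop,
      ∃ w, ¬(w ∈ M'.acceptsFrom q ↔ w ∈ M'.acceptsFrom q') ∧ ∀ p, w ∈ M.acceptsFrom p ↔ T) :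
    (boolOp f M.accepts M'.accepts).complexity = ENat.card (σ × σ') := by
  rw [complexity, quotients_boolOp_accepts hreach, ← Set.image_univ,
    Function.Injective.encard_image, Set.encard_univ]
  rintro ⟨p, q⟩ ⟨p', q'⟩ h
  by_contra hne
  rcases ne_or_eq p p' with hp | rfl
  · refine boolOp_ne_boolOp hf (fun T => ?_) h
    obtain ⟨w, hw, hT⟩ := hsep p p' hp T
    exact ⟨w, hw, hT q, hT q'⟩
  · refine boolOp_ne_boolOp (isProper_flip hf) (fun T => ?_) h
    obtain ⟨w, hw, hT⟩ := hsep' q q' (fun hq => hne (hq ▸ rfl)) T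
    exact ⟨w, hw, hT p, hT p⟩

/-- The states of the direct product of two DFAs that are reachable from the pair of initial
states. -/
def reachablePairs (M : DFA α σ) (M' : DFA α σ') : Set (σ × σ') :=
  Set.range fun w => (M.eval w, M'.eval w)

theorem swap_mem_reachablePairs {p : σ} {q : σ'} (h : (p, q) ∈ reachablePairs M M') :
    (q, p) ∈ reachablePairs M' M := by
  obtain ⟨w, hw⟩ := h
  exact ⟨w, Prod.swap_inj.2 hw⟩

theorem wordMap_mem_reachablePairs {p : σ} {q : σ'} (h : (p, q) ∈ reachablePairs M M')
    (w : List α) : (wordMap M w p, wordMap M' w q) ∈ reachablePairs M M' := by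
  obtain ⟨u, hu⟩ := h
  obtain ⟨rfl, rfl⟩ := Prod.mk.inj hu
  exact ⟨u ++ w, Prod.ext (M.evalFrom_of_append _ _ _) (M'.evalFrom_of_append _ _ _)⟩

theorem mem_reachablePairs_of_wordMap_mem [Finite σ] [Finite σ'] {w : List α}
    (hM : Function.Injective (wordMap M w)) (hM' : Function.Injective (wordMap M' w)) {p : σ}
    {q : σ'} (h : (wordMap M w p, wordMap M' w q) ∈ reachablePairs M M') :
    (p, q) ∈ reachablePairs M M' := by
  have hinj : Function.Injective (Prod.map (wordMap M w) (wordMap M' w)) := hM.prodMap hM'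
  have hmaps : Set.MapsTo (Prod.map (wordMap M w) (wordMap M' w)) (reachablePairs M M')
      (reachablePairs M M') := fun _ hx => wordMap_mem_reachablePairs hx w
  obtain ⟨x, hx, hxpq⟩ :=
    (((Set.toFinite _).injOn_iff_bijOn_of_mapsTo hmaps).1 hinj.injOn).surjOn h
  obtain rfl : x = (p, q) := hinj hxpq
  exact hx

end BoolOp

section WitnessBoolOp

variable {m n : ℕ} {hm : 4 ≤ m} {hn : 4 ≤ n} {β : Type*} {ρ₁ ρ₂ : β → Letter} {a c e : β}

theorem val_witnessStep_a_last {q : Fin n} (hq : q.1 = n - 1) : (witnessStep hn .a q).1 = 1 := by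
  rw [val_witnessStep_a]
  split_ifs <;> omega

theorem exists_iterate_a_eq {p r : Fin m} (hp : 1 ≤ p.1) (hr : 1 ≤ r.1) :
    ∃ i, (witnessStep hm .a)^[i] p = r := by
  have hlast := val_iterate_witnessStep_a hm hp (k := m - 1 - p.1) (by omega)
  have hone : (witnessStep hm .a ((witnessStep hm .a)^[m - 1 - p.1] p)).1 = 1 :=
    val_witnessStep_a_last (hlast.trans (by omega))
  refine ⟨(r.1 - 1) + 1 + (m - 1 - p.1), Fin.ext ?_⟩
  rw [Function.iterate_add_apply, Function.iterate_succ_apply,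
    val_iterate_witnessStep_a hm hone.ge (by omega), hone]
  omega

theorem one_le_of_iterate_a_eq_last {p : Fin m} {k : ℕ}
    (h : ((witnessStep hm .a)^[k] p).1 = m - 1) : 1 ≤ p.1 := by
  by_contra hp
  rw [iterate_witnessStep_a_zero hm (by omega)] at h
  omega

theorem exists_synchronized_iterate (hm : 4 ≤ m) (hn : 4 ≤ n) :
    ∃ (k : ℕ) (r : Fin m), r.1 ≠ m - 1 ∧ ((witnessStep hm .a)^[k] r).1 = m - 1 ∧
      ∀ q : Fin n, q.1 = 1 → ((witnessStep hn .a)^[k] q).1 = n - 1 := by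
  have hsync (q : Fin n) (hq : q.1 = 1) : ((witnessStep hn .a)^[n - 2] q).1 = n - 1 := by
    rw [val_iterate_witnessStep_a hn hq.ge (by omega)]
    omega
  obtain ⟨p, hp⟩ := ((witnessStep_a_bijective hm).iterate (n - 2)).surjective ⟨m - 1, by omega⟩
  by_cases hlast : p.1 = m - 1
  · -- The cycle length `m - 1` divides `n - 2`, hence not `2n - 3`.
    have hfix : (witnessStep hm .a)^[n - 2] p = p := hp.trans (Fin.ext hlast.symm)
    refine ⟨(n - 2) + ((n - 2) + 1), ⟨m - 2, by omega⟩, by simp only; omega, ?_, fun q hq => ?_⟩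
    · have hstep : witnessStep hm .a ⟨m - 2, by omega⟩ = p := by
        ext
        rw [val_witnessStep_a, hlast]
        simp only
        split_ifs <;> omega
      rw [Function.iterate_add_apply, Function.iterate_succ_apply, hstep, hfix, hfix, hlast]
    · rw [Function.iterate_add_apply, Function.iterate_succ_apply', hsync _ ?_]
      exact val_witnessStep_a_last (hsync q hq)
  · exact ⟨n - 2, p, hlast, congrArg Fin.val hp, hsync⟩

theorem exists_iterate_last_iff (hm : 4 ≤ m) (hn : 4 ≤ n) (T : Prop) :
    ∃ (k : ℕ) (r : Fin m), r.1 ≠ m - 1 ∧ ((witnessStep hm .a)^[k] r).1 = m - 1 ∧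
      ∀ q : Fin n, q.1 = 1 → (((witnessStep hn .a)^[k] q).1 = n - 1 ↔ T) := by
  by_cases hT : T
  · obtain ⟨k, r, hr, hk, hq⟩ := exists_synchronized_iterate hm hn
    exact ⟨k, r, hr, hk, fun q hq1 => iff_of_true (hq q hq1) hT⟩
  · refine ⟨1, ⟨m - 2, by omega⟩, by simp only; omega, ?_, fun q hq => iff_of_false ?_ hT⟩
    · rw [Function.iterate_one, val_witnessStep_a]
      simp only
      split_ifs <;> omega
    · rw [Function.iterate_one, val_witnessStep_a, hq]
      split_ifs <;> omega

theorem exists_iterate_a_c_separating (hm : 4 ≤ m) {p p' r : Fin m} (hpp : p ≠ p')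
    (hr : 1 ≤ r.1) (hlast : r.1 ≠ m - 1) :
    ∃ i, ¬(witnessStep hm .c ((witnessStep hm .a)^[i] p) = r ↔
      witnessStep hm .c ((witnessStep hm .a)^[i] p') = r) := by
  wlog hp : 1 ≤ p.1 generalizing p p'
  · obtain ⟨i, hi⟩ := this hpp.symm (by by_contra h; exact hpp (Fin.ext (by omega)))
    exact ⟨i, fun h => hi h.symm⟩
  obtain ⟨i, hi⟩ := exists_iterate_a_eq (hm := hm) hp hr
  have hne : (witnessStep hm .a)^[i] p' ≠ r := fun h =>
    hpp ((witnessStep_a_injective hm).iterate i (hi.trans h.symm))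
  by_cases hc : witnessStep hm .c ((witnessStep hm .a)^[i] p') = r
  · -- Then `r` has index 1, and `c` cannot tell it from the last state; one more `a` moves both.
    have hp' : ((witnessStep hm .a)^[i] p').1 = m - 1 := by
      by_contra h
      exact hne (witnessStep_c_of_ne hm h ▸ hc)
    have hr1 : r.1 = 1 := by rw [← hc, val_witnessStep_c_last hm hp']
    have hstep' : (witnessStep hm .a)^[i + 1] p' = r := by
      ext
      rw [Function.iterate_succ_apply', val_witnessStep_a_last hp', hr1]
    have hstep : ((witnessStep hm .a)^[i + 1] p).1 = 2 := by
      rw [Function.iterate_succ_apply', hi, val_witnessStep_a, hr1]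
      split_ifs <;> omega
    refine ⟨i + 1, fun h => ?_⟩
    have hval := congrArg Fin.val (h.2 (by rw [hstep', witnessStep_c_of_ne hm hlast]))
    rw [witnessStep_c_of_ne hm (by omega)] at hval
    omega
  · exact ⟨i, fun h => hc (h.1 (by rw [hi, witnessStep_c_of_ne hm hlast]))⟩

theorem wordMap_witnessComap_a_x_a (ha : ρ₁ a = .a) (x : β) (i k : ℕ) (q : Fin n) :
    wordMap (witnessComap n hn ρ₁) (List.replicate i a ++ x :: List.replicate k a) q =
      (witnessStep hn .a)^[k] (witnessStep hn (ρ₁ x) ((witnessStep hn .a)^[i] q)) := by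
  rw [wordMap_append, wordMap_cons, wordMap_witnessComap_replicate_a ha,
    wordMap_witnessComap_replicate_a ha, wordMap_witnessComap_singleton]
  rfl

theorem exists_separating_word (ha₁ : ρ₁ a = .a) (ha₂ : ρ₂ a = .a) (hc₁ : ρ₁ c = .c)
    (hc₂ : ρ₂ c = .e) {p p' : Fin m} (hpp : p ≠ p') (T : Prop) :
    ∃ w : List β,
      ¬(w ∈ (witnessComap m hm ρ₁).acceptsFrom p ↔ w ∈ (witnessComap m hm ρ₁).acceptsFrom p') ∧
      ∀ q : Fin n, w ∈ (witnessComap n hn ρ₂).acceptsFrom q ↔ T := by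
  obtain ⟨k, r, hlast, hk, hT⟩ := exists_iterate_last_iff hm hn T
  obtain ⟨i, hi⟩ :=
    exists_iterate_a_c_separating hm hpp (one_le_of_iterate_a_eq_last hk) hlast
  have hmem (u : Fin m) : List.replicate i a ++ c :: List.replicate k a ∈
      (witnessComap m hm ρ₁).acceptsFrom u ↔
        witnessStep hm .c ((witnessStep hm .a)^[i] u) = r := by
    rw [mem_acceptsFrom_witnessComap, wordMap_witnessComap_a_x_a ha₁, hc₁,
      ← ((witnessStep_a_injective hm).iterate k).eq_iff (b := r), Fin.ext_iff, hk]
  refine ⟨List.replicate i a ++ c :: List.replicate k a, by rwa [hmem, hmem], fun q => ?_⟩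
  rw [mem_acceptsFrom_witnessComap, wordMap_witnessComap_a_x_a ha₂, hc₂]
  exact hT _ rfl

theorem mem_reachablePairs_zero (ha₁ : ρ₁ a = .a) (ha₂ : ρ₂ a = .a) (he₁ : ρ₁ e = .e)
    (he₂ : ρ₂ e = .c) (p : Fin m) {q : Fin n} (hq : q.1 = 0) :
    (p, q) ∈ reachablePairs (witnessComap m hm ρ₁) (witnessComap n hn ρ₂) := by
  have hstart : ((⟨0, by omega⟩ : Fin m), q) ∈
      reachablePairs (witnessComap m hm ρ₁) (witnessComap n hn ρ₂) :=
    ⟨[], Prod.ext rfl (Fin.ext hq.symm)⟩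
  rcases Nat.eq_zero_or_pos p.1 with hp | hp
  · exact (Fin.ext hp : p = ⟨0, _⟩) ▸ hstart
  · convert wordMap_mem_reachablePairs hstart (e :: List.replicate (p.1 - 1) a) using 2
    · ext
      rw [val_wordMap_witnessComap_e_a ha₁ he₁ _ (by omega)]
      omega
    · rw [wordMap_cons, wordMap_witnessComap_replicate_a ha₂, wordMap_witnessComap_singleton, he₂,
        Function.comp_apply, witnessStep_c_of_ne hn (by omega), iterate_witnessStep_a_zero hn hq]

theorem mem_reachablePairs_one (ha₁ : ρ₁ a = .a) (ha₂ : ρ₂ a = .a) (hc₁ : ρ₁ c = .c)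
    (hc₂ : ρ₂ c = .e) (he₁ : ρ₁ e = .e) (he₂ : ρ₂ e = .c) (p : Fin m) {q : Fin n}
    (hq : q.1 = 1) : (p, q) ∈ reachablePairs (witnessComap m hm ρ₁) (witnessComap n hn ρ₂) := by
  by_cases hp : p.1 = m - 1
  · refine mem_reachablePairs_of_wordMap_mem (w := [a])
      (by rw [wordMap_witnessComap_singleton, ha₁]; exact witnessStep_a_injective hm)
      (by rw [wordMap_witnessComap_singleton, ha₂]; exact witnessStep_a_injective hn) ?_
    have hpair : ((⟨0, by omega⟩ : Fin m), (⟨2, by omega⟩ : Fin n)) ∈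
        reachablePairs (witnessComap m hm ρ₁) (witnessComap n hn ρ₂) :=
      swap_mem_reachablePairs (mem_reachablePairs_zero ha₂ ha₁ hc₂ hc₁ _ rfl)
    convert wordMap_mem_reachablePairs hpair [e] using 2
    · ext
      rw [wordMap_witnessComap_singleton, wordMap_witnessComap_singleton, ha₁, he₁,
        val_witnessStep_a_last hp, val_witnessStep_e]
    · ext
      rw [wordMap_witnessComap_singleton, wordMap_witnessComap_singleton, ha₂, he₂,
        witnessStep_c_of_ne hn (q := ⟨2, by omega⟩) (by simp only; omega), val_witnessStep_a, hq]
      simp only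
      split_ifs <;> omega
  · have hpair := mem_reachablePairs_zero (hm := hm) (hn := hn) (q := ⟨0, by omega⟩)
      ha₁ ha₂ he₁ he₂ p rfl
    convert wordMap_mem_reachablePairs hpair [c] using 2
    · rw [wordMap_witnessComap_singleton, hc₁, witnessStep_c_of_ne hm hp]
    · ext
      rw [wordMap_witnessComap_singleton, hc₂, val_witnessStep_e, hq]

theorem mem_reachablePairs (ha₁ : ρ₁ a = .a) (ha₂ : ρ₂ a = .a) (hc₁ : ρ₁ c = .c)
    (hc₂ : ρ₂ c = .e) (he₁ : ρ₁ e = .e) (he₂ : ρ₂ e = .c) (p : Fin m) (q : Fin n) :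
    (p, q) ∈ reachablePairs (witnessComap m hm ρ₁) (witnessComap n hn ρ₂) := by
  rcases Nat.eq_zero_or_pos q.1 with hq | hq
  · exact mem_reachablePairs_zero ha₁ ha₂ he₁ he₂ p hq
  · obtain ⟨p, rfl⟩ := ((witnessStep_a_bijective hm).iterate (q.1 - 1)).surjective p
    have hpair := mem_reachablePairs_one (hm := hm) (hn := hn) (q := ⟨1, by omega⟩)
      ha₁ ha₂ hc₁ hc₂ he₁ he₂ p rfl
    convert wordMap_mem_reachablePairs hpair (List.replicate (q.1 - 1) a) using 2
    · rw [wordMap_witnessComap_replicate_a ha₁]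
    · ext
      rw [wordMap_witnessComap_replicate_a ha₂, val_iterate_witnessStep_a hn le_rfl] <;>
        simp only <;> omega

theorem complexity_boolOp_witnessComap {f : Bool → Bool → Bool} (hf : IsProper f)
    {ρ : β → Letter} (hρ : {.a, .c, .e} ⊆ Set.range ρ) :
    (boolOp f (witnessComap m hm ρ).accepts
      (witnessComap n hn (Equiv.swap .c .e ∘ ρ)).accepts).complexity = (m * n : ℕ) := by
  simp only [Set.insert_subset_iff, Set.singleton_subset_iff] at hρ
  obtain ⟨⟨a, ha₁⟩, ⟨c, hc₁⟩, ⟨e, he₁⟩⟩ := hρ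
  have ha₂ : (Equiv.swap .c .e ∘ ρ) a = .a := by rw [Function.comp_apply, ha₁]; rfl
  have hc₂ : (Equiv.swap .c .e ∘ ρ) c = .e := by rw [Function.comp_apply, hc₁]; rfl
  have he₂ : (Equiv.swap .c .e ∘ ρ) e = .c := by rw [Function.comp_apply, he₁]; rfl
  rw [complexity_boolOp_accepts hf (fun p q => ?_)
    (fun p p' hpp => exists_separating_word ha₁ ha₂ hc₁ hc₂ hpp)
    (fun q q' hqq => exists_separating_word ha₂ ha₁ he₂ he₁ hqq), ENat.card_eq_coe_fintype_card,
    Fintype.card_prod, Fintype.card_fin, Fintype.card_fin]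
  obtain ⟨w, hw⟩ := mem_reachablePairs ha₁ ha₂ hc₁ hc₂ he₁ he₂ p q
  exact ⟨w, Prod.mk.inj hw⟩

end WitnessBoolOp

section Dialects

variable {n : ℕ} {hn : 4 ≤ n}

theorem map_eq_map_some_iff {α β γ : Type*} {π : α → Option γ} {ρ : β → α} {v : β → γ}
    (h : ∀ x y, π x = some (v y) ↔ x = ρ y) (u : List α) (w : List β) :
    u.map π = (w.map v).map some ↔ u = w.map ρ := by
  induction u generalizing w with
  | nil => cases w <;> simp
  | cons x u ih =>
    cases w with
    | nil => simp
    | cons y w => simp only [List.map_cons, List.cons.injEq, h, ih]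

theorem map_mem_dialect_iff {α β : Type*} {π : α → Option α} {ρ v : β → α}
    (h : ∀ x y, π x = some (v y) ↔ x = ρ y) {L : Language α} {w : List β} :
    w.map v ∈ L.dialect π ↔ w.map ρ ∈ L := by
  refine ⟨fun ⟨u, hu, huw⟩ => (map_eq_map_some_iff h u w).1 huw ▸ hu, fun hw => ?_⟩
  exact ⟨_, hw, (map_eq_map_some_iff h _ w).2 rfl⟩

theorem mem_accepts_witnessComap {β : Type*} {ρ : β → Letter} {w : List β} :
    w ∈ (witnessComap n hn ρ).accepts ↔ w.map ρ ∈ witness n hn :=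
  Set.ext_iff.1 ((witnessDFA n hn).accepts_comap ρ) w

theorem dialect_witness_eq {π : Letter → Option Letter} {ρ : Letter → Letter}
    (h : ∀ x y, π x = some y ↔ x = ρ y) :
    (witness n hn).dialect π = (witnessComap n hn ρ).accepts := by
  ext w
  rw [mem_accepts_witnessComap, ← map_mem_dialect_iff (v := id) h, List.map_id]

theorem witnessOver_eq {Γ : Set Letter} {π : Letter → Option Letter} {ρ : Γ → Letter}
    (h : ∀ x (y : Γ), π x = some y.1 ↔ x = ρ y) :
    witnessOver n hn Γ π = (witnessComap n hn ρ).accepts := by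
  ext w
  rw [mem_accepts_witnessComap, ← map_mem_dialect_iff h]
  rfl

theorem witness_eq : witness n hn = (witnessComap n hn id).accepts := rfl

theorem dialect_witness_abedc :
    (witness n hn).dialect (assign (some .a) (some .b) (some .e) (some .d) (some .c)) =
      (witnessComap n hn (Equiv.swap .c .e ∘ id)).accepts :=
  dialect_witness_eq (by decide)

theorem witnessOver_ade :
    witnessOver n hn {.a, .d, .e} (assign (some .a) none none (some .d) (some .e)) =
      (witnessComap n hn Subtype.val).accepts :=
  witnessOver_eq (by simp +decide)

theorem witnessOver_acde :
    witnessOver n hn {.a, .c, .d, .e} (assign (some .a) none (some .c) (some .d) (some .e)) =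
      (witnessComap n hn Subtype.val).accepts :=
  witnessOver_eq (by simp +decide)

theorem witnessOver_ae :
    witnessOver n hn {.a, .e} (assign (some .a) none none none (some .e)) =
      (witnessComap n hn Subtype.val).accepts :=
  witnessOver_eq (by simp +decide)

theorem witnessOver_ace :
    witnessOver n hn {.a, .c, .e} (assign (some .a) none (some .c) none (some .e)) =
      (witnessComap n hn Subtype.val).accepts :=
  witnessOver_eq (by simp +decide)

theorem witnessOver_aec :
    witnessOver n hn {.a, .c, .e} (assign (some .a) none (some .e) none (some .c)) =
      (witnessComap n hn (Equiv.swap .c .e ∘ Subtype.val)).accepts :=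
  witnessOver_eq (by simp +decide)

end Dialects

theorem isMinimal_witnessDFA {n : ℕ} (hn : 4 ≤ n) : (witnessDFA n hn).IsMinimal :=
  isMinimal_witnessComap (hn := hn) (ρ := id) (a := .a) (e := .e) rfl rfl

theorem witness_mem_ofComplexity {n : ℕ} (hn : 4 ≤ n) :
    witness n hn ∈ ofComplexity RegularLeftIdeal n Letter :=
  accepts_witnessComap_mem_ofComplexity (hn := hn) (ρ := id) (by simp)

theorem witnessOver_mem_ofComplexity {n : ℕ} (hn : 4 ≤ n) :
    witnessOver n hn {.a, .d, .e} (assign (some .a) none none (some .d) (some .e))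
        ∈ ofComplexity RegularLeftIdeal n _ ∧
      witnessOver n hn {.a, .c, .d, .e} (assign (some .a) none (some .c) (some .d) (some .e))
        ∈ ofComplexity RegularLeftIdeal n _ ∧
      witnessOver n hn {.a, .e} (assign (some .a) none none none (some .e))
        ∈ ofComplexity RegularLeftIdeal n _ ∧
      witnessOver n hn {.a, .c, .e} (assign (some .a) none (some .c) none (some .e))
        ∈ ofComplexity RegularLeftIdeal n _ ∧
      witnessOver n hn {.a, .c, .e} (assign (some .a) none (some .e) none (some .c))
        ∈ ofComplexity RegularLeftIdeal n _ := by
  rw [witnessOver_ade, witnessOver_acde, witnessOver_ae, witnessOver_ace, witnessOver_aec]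
  refine ⟨?_, ?_, ?_, ?_, ?_⟩ <;> apply accepts_witnessComap_mem_ofComplexity <;>
    simp +decide [Set.insert_subset_iff]

theorem syntacticSize_witness {n : ℕ} (hn : 4 ≤ n) :
    (witness n hn).syntacticSize = (n ^ (n - 1) + n - 1 : ℕ) :=
  syntacticSize_witnessComap (hn := hn) (ρ := id) Function.surjective_id

theorem complexity_atom_witness {n : ℕ} (hn : 4 ≤ n) {A : Language Letter}
    (hA : A ∈ (witness n hn).atoms) :
    A.complexity = atomBound n ((witness n hn).atomIndex A).ncard :=
  complexity_atom_witnessComap (hn := hn) (ρ := id) Function.surjective_id hA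

theorem nonempty_equiv_quotients {α β : Type*} {L : Language α} {K : Language β} {n : ℕ}
    (hL : L.complexity = n) (hK : K.complexity = n) : Nonempty (L.quotients ≃ K.quotients) := by
  have : Finite L.quotients := Set.finite_of_encard_eq_coe hL
  have : Finite K.quotients := Set.finite_of_encard_eq_coe hK
  have hcard : L.quotients.ncard = K.quotients.ncard :=
    congrArg ENat.toNat (hL.trans hK.symm)
  exact Finite.card_eq.1 hcard

theorem isMostComplex_witness :
    IsMostComplex RegularLeftIdeal 4 witness
      (assign (some .a) (some .b) (some .e) (some .d) (some .c)) where
  isPartialPerm := by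
    unfold IsPartialPerm
    decide
  mem _ hn := witness_mem_ofComplexity hn
  semigroup n hn α _ K hK := (syntacticSize_le hn hK).trans_eq (syntacticSize_witness hn).symm
  quotient n hn α _ K hK := by
    obtain ⟨φ⟩ := nonempty_equiv_quotients hK.2 (witness_mem_ofComplexity hn).2
    refine ⟨φ, fun q => (complexity_quotient_le hK q.2).trans_eq ?_⟩
    exact (complexity_quotient_witnessComap (hn := hn) (ρ := id) (by simp) (φ q).2).symm
  atoms n hn α _ K hK := by
    rw [witness_eq, encard_atoms_witnessComap (by simp)]
    exact encard_atoms_le hK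
  atom n hn α _ K hK A hA B hB h := by
    rw [complexity_atom_witness hn hB, Set.ncard, ← h]
    exact complexity_atom_le (by omega) hK hA
  reverse n hn α _ K hK := by
    rw [complexity_reverse, complexity_reverse, witness_eq, encard_atoms_witnessComap (by simp)]
    exact encard_atoms_le hK
  star n hn α _ K hK := by
    rw [witness_eq, complexity_kstar_witnessComap (by simp)]
    exact complexity_kstar_le hK
  product m hm n hn α _ K hK K' hK' := by
    rw [witness_eq, witness_eq, complexity_mul_witnessComap (by simp)]
    exact complexity_mul_le hK hK'
  boolean m hm n hn f hf α _ K hK K' hK' := by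
    rw [dialect_witness_abedc, witness_eq, complexity_boolOp_witnessComap hf (by simp)]
    exact complexity_boolOp_le f hK hK'

end MostComplex

theorem mainTheorem1 :
    -- `D_n` is minimal and `L_n` is a (regular) left ideal of complexity `n`
    (∀ (n : ℕ) (hn : 4 ≤ n), (witnessDFA n hn).IsMinimal ∧
      witness n hn ∈ ofComplexity RegularLeftIdeal n Letter) ∧
    -- the stream, with the dialect stream `L_n(a,b,e,d,c)`, is most complex
    IsMostComplex RegularLeftIdeal 4 witness
      (assign (some .a) (some .b) (some .e) (some .d) (some .c)) ∧
    -- the dialects over restricted alphabets used below are left ideals of complexity `n`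
    (∀ (n : ℕ) (hn : 4 ≤ n),
      witnessOver n hn {.a, .d, .e} (assign (some .a) none none (some .d) (some .e))
        ∈ ofComplexity RegularLeftIdeal n _ ∧
      witnessOver n hn {.a, .c, .d, .e}
        (assign (some .a) none (some .c) (some .d) (some .e))
        ∈ ofComplexity RegularLeftIdeal n _ ∧
      witnessOver n hn {.a, .e} (assign (some .a) none none none (some .e))
        ∈ ofComplexity RegularLeftIdeal n _ ∧
      witnessOver n hn {.a, .c, .e} (assign (some .a) none (some .c) none (some .e))
        ∈ ofComplexity RegularLeftIdeal n _ ∧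
      witnessOver n hn {.a, .c, .e} (assign (some .a) none (some .e) none (some .c))
        ∈ ofComplexity RegularLeftIdeal n _) ∧
    -- 1. syntactic semigroup: value, maximality, and at least five letters are needed
    (∀ (n : ℕ) (hn : 4 ≤ n),
      (witness n hn).syntacticSize = ((n ^ (n - 1) + n - 1 : ℕ) : ℕ∞) ∧
      (∀ (α : Type) [Finite α], ∀ K ∈ ofComplexity RegularLeftIdeal n α,
        K.syntacticSize ≤ ((n ^ (n - 1) + n - 1 : ℕ) : ℕ∞)) ∧
      (∀ (α : Type) [Finite α], Nat.card α < 5 → ∀ K ∈ ofComplexity RegularLeftIdeal n α,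
        K.syntacticSize < ((n ^ (n - 1) + n - 1 : ℕ) : ℕ∞))) ∧
    -- 2. quotients of `L_n(a,-,-,d,e)`
    (∀ (n : ℕ) (hn : 4 ≤ n),
      (∀ q : Language ({.a, .d, .e} : Set Letter),
        q ∈ (witnessOver n hn {.a, .d, .e}
          (assign (some .a) none none (some .d) (some .e))).quotients →
        q.complexity = (n : ℕ∞)) ∧
      (∀ (α : Type) [Finite α], ∀ K ∈ ofComplexity RegularLeftIdeal n α,
        ∀ q ∈ K.quotients, q.complexity ≤ (n : ℕ∞))) ∧
    -- 3. number of atoms of `L_n(a,-,c,d,e)`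
    (∀ (n : ℕ) (hn : 4 ≤ n),
      (witnessOver n hn {.a, .c, .d, .e}
        (assign (some .a) none (some .c) (some .d) (some .e))).atoms.encard
        = ((2 ^ (n - 1) + 1 : ℕ) : ℕ∞) ∧
      (∀ (α : Type) [Finite α], ∀ K ∈ ofComplexity RegularLeftIdeal n α,
        K.atoms.encard ≤ ((2 ^ (n - 1) + 1 : ℕ) : ℕ∞))) ∧
    -- 4. complexity of the atoms of `L_n(a,b,c,d,e)`
    (∀ (n : ℕ) (hn : 4 ≤ n),
      (∀ A ∈ (witness n hn).atoms,
        A.complexity = (atomBound n ((witness n hn).atomIndex A).ncard : ℕ∞)) ∧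
      (∀ (α : Type) [Finite α], ∀ K ∈ ofComplexity RegularLeftIdeal n α, ∀ A ∈ K.atoms,
        A.complexity ≤ (atomBound n (K.atomIndex A).ncard : ℕ∞))) ∧
    -- 5. reverse of `L_n(a,-,c,d,e)`
    (∀ (n : ℕ) (hn : 4 ≤ n),
      (witnessOver n hn {.a, .c, .d, .e}
        (assign (some .a) none (some .c) (some .d) (some .e))).reverse.complexity
        = ((2 ^ (n - 1) + 1 : ℕ) : ℕ∞) ∧
      (∀ (α : Type) [Finite α], ∀ K ∈ ofComplexity RegularLeftIdeal n α,
        K.reverse.complexity ≤ ((2 ^ (n - 1) + 1 : ℕ) : ℕ∞))) ∧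
    -- 6. star of `L_n(a,-,-,-,e)`
    (∀ (n : ℕ) (hn : 4 ≤ n),
      ((witnessOver n hn {.a, .e}
        (assign (some .a) none none none (some .e)))∗).complexity = ((n + 1 : ℕ) : ℕ∞) ∧
      (∀ (α : Type) [Finite α], ∀ K ∈ ofComplexity RegularLeftIdeal n α,
        (K∗).complexity ≤ ((n + 1 : ℕ) : ℕ∞))) ∧
    -- 7. product of `L_m(a,-,-,-,e)` and `L_n(a,-,-,-,e)`
    (∀ (m : ℕ) (hm : 4 ≤ m) (n : ℕ) (hn : 4 ≤ n),
      (witnessOver m hm {.a, .e} (assign (some .a) none none none (some .e)) *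
        witnessOver n hn {.a, .e}
          (assign (some .a) none none none (some .e))).complexity
        = ((m + n - 1 : ℕ) : ℕ∞) ∧
      (∀ (α : Type) [Finite α], ∀ K ∈ ofComplexity RegularLeftIdeal m α,
        ∀ K' ∈ ofComplexity RegularLeftIdeal n α,
          (K * K').complexity ≤ ((m + n - 1 : ℕ) : ℕ∞))) ∧
    -- 8. proper boolean operations on `L_m(a,-,c,-,e)` and `L_n(a,-,e,-,c)`
    (∀ (m : ℕ) (hm : 4 ≤ m) (n : ℕ) (hn : 4 ≤ n) (f : Bool → Bool → Bool), IsProper f →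
      (boolOp f
        (witnessOver m hm {.a, .c, .e}
          (assign (some .a) none (some .c) none (some .e)))
        (witnessOver n hn {.a, .c, .e}
          (assign (some .a) none (some .e) none (some .c)))).complexity
        = ((m * n : ℕ) : ℕ∞) ∧
      (∀ (α : Type) [Finite α], ∀ K ∈ ofComplexity RegularLeftIdeal m α,
        ∀ K' ∈ ofComplexity RegularLeftIdeal n α,
          (boolOp f K K').complexity ≤ ((m * n : ℕ) : ℕ∞))) := by
  refine ⟨fun n hn => ⟨isMinimal_witnessDFA hn, witness_mem_ofComplexity hn⟩,
    isMostComplex_witness, fun n hn => witnessOver_mem_ofComplexity hn,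
    fun n hn => ⟨syntacticSize_witness hn, fun α _ K hK => syntacticSize_le hn hK,
      fun α _ hα K hK => syntacticSize_lt hn hα hK⟩,
    fun n hn => ⟨fun q hq => ?_, fun α _ K hK q hq => complexity_quotient_le hK hq⟩,
    fun n hn => ⟨?_, fun α _ K hK => encard_atoms_le hK⟩,
    fun n hn => ⟨fun A hA => complexity_atom_witness hn hA,
      fun α _ K hK A hA => complexity_atom_le (by omega) hK hA⟩,
    fun n hn => ⟨?_, fun α _ K hK => (complexity_reverse K).trans_le (encard_atoms_le hK)⟩,
    fun n hn => ⟨?_, fun α _ K hK => complexity_kstar_le hK⟩,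
    fun m hm n hn => ⟨?_, fun α _ K hK K' hK' => complexity_mul_le hK hK'⟩,
    fun m hm n hn f hf => ⟨?_, fun α _ K hK K' hK' => complexity_boolOp_le f hK hK'⟩⟩
  · rw [witnessOver_ade] at hq
    exact complexity_quotient_witnessComap Subtype.range_coe.ge hq
  · rw [witnessOver_acde, encard_atoms_witnessComap Subtype.range_coe.ge]
  · rw [complexity_reverse, witnessOver_acde, encard_atoms_witnessComap Subtype.range_coe.ge]
  · rw [witnessOver_ae, complexity_kstar_witnessComap Subtype.range_coe.ge]
  · rw [witnessOver_ae, witnessOver_ae, complexity_mul_witnessComap Subtype.range_coe.ge]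
  · rw [witnessOver_ace, witnessOver_aec, complexity_boolOp_witnessComap hf Subtype.range_coe.ge]
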